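/- Let $l$ be a prime number and $K$ a finite extension of $\mathbf{Q}_l$ such that $K^\times$ has an element of order $l$. Let $e$ be the ramification index of $K|\mathbf{Q}_l$, $f$ its residual degree, $d=[K:\mathbf{Q}_l]$, and $e_1=e/(l-1)$, which is an integer. For $n\ge 0$ put $\delta_l(n)=1+l+l^2+\cdots+l^n$; put $\mu(t)=(t-\lfloor t/l\rfloor)f$ for integers $t\in[0,le_1[$ and $\mu(le_1)=1+d$. Degree-$l$ kummerian extensions of $K$ are the subfields $L=K(x)$ of a fixed algebraic closure of $K$ with $x^l\in K$ and $[L:K]=l$. For such an $L$, let $G=\mathrm{Gal}(L|K)$ and, for $n\ge -1$, let $G_n$ be the subgroup of $G$ acting trivially on $\mathfrak{o}_L/\mathfrak{l}_L^{\,n+1}$, where $\mathfrak{o}_L$ is the ring of integers of $L$ and $\mathfrak{l}_L$ its maximal ideal; the ramification break of $L|K$ occurs at $t$ if $G_t=G$ and $G_{t+1}=\{\mathrm{Id}_L\}$. Denote by $d_{L|K}$ the discriminant of $L|K$ and by $v_K$ the normalised valuation of $K$. (a) For every integer $t\in[1,le_1]$, the number of degree-$l$ kummerian extensions of $K$ whose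 ramification break occurs at $t$ is finite and equal to $\delta_l(\mu(t))-\delta_l(\mu(t-1))$. When $t$ is a multiple of $l$, this number vanishes if $t\neq le_1$, and does not vanish if $t=le_1$. (b) There are exactly $e$ integers $t_1<t_2<\cdots<t_e$ in $[1,le_1[$ which are prime to $l$; put also $t_{e+1}=le_1$. For $i\in[1,e]$, the number of degree-$l$ kummerian extensions $L|K$ with $v_K(d_{L|K})=(l-1)(1+t_i)$ is finite and equal to $n_i=l^{(i-1)f+1}+l^{(i-1)f+2}+\cdots+l^{if}$; the number of those with $v_K(d_{L|K})=(l-1)(1+t_{e+1})=(l-1)(1+le_1)$ is finite and equal to $n_{e+1}=l^{1+d}$. -/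

import Mathlib

namespace LocalKummer

open scoped IntermediateField

/-! ### Rings of integers -/

/-- An element of an algebraic extension of `ℚ_l` is integral over `ℤ_l` iff its
(unique) extended absolute value is at most one. -/
theorem isIntegral_iff_spectralNorm_le_one (l : ℕ) [Fact l.Prime] (L : Type*) [Field L]
    [Algebra ℚ_[l] L] [Algebra ℤ_[l] L] [IsScalarTower ℤ_[l] ℚ_[l] L]
    [Algebra.IsAlgebraic ℚ_[l] L] (x : L) :
    IsIntegral ℤ_[l] x ↔ spectralNorm ℚ_[l] L x ≤ 1 := by
  have hx : IsIntegral ℚ_[l] x := Algebra.IsIntegral.isIntegral x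
  rw [spectralNorm, spectralValue_le_one_iff (minpoly.monic hx)]
  constructor
  · intro h n
    rw [minpoly.isIntegrallyClosed_eq_field_fractions' ℚ_[l] h, Polynomial.coeff_map]
    exact PadicInt.norm_le_one _
  · intro h
    have hl : minpoly ℚ_[l] x ∈ Polynomial.lifts (algebraMap ℤ_[l] ℚ_[l]) := by
      rw [Polynomial.lifts_iff_coeff_lifts]
      intro n
      exact ⟨⟨_, h n⟩, rfl⟩
    obtain ⟨q, hq, -, hqm⟩ := Polynomial.lifts_and_degree_eq_and_monic hl (minpoly.monic hx)
    refine ⟨q, hqm, ?_⟩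
    have := minpoly.aeval ℚ_[l] x
    rwa [← hq, Polynomial.aeval_map_algebraMap] at this

/-- In an algebraic extension `L` of `ℚ_l`, the ring of elements integral over `ℤ_l` is local. -/
theorem isLocalRing_of_mem_iff (l : ℕ) [Fact l.Prime] {L : Type*} [Field L]
    [Algebra ℚ_[l] L] [Algebra ℤ_[l] L] [IsScalarTower ℤ_[l] ℚ_[l] L]
    [Algebra.IsAlgebraic ℚ_[l] L] {R : Type*} [CommRing R] [Algebra R L] (S : Subalgebra R L)
    (hS : ∀ x : L, x ∈ S ↔ IsIntegral ℤ_[l] x) : IsLocalRing S := by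
  have hS' : ∀ x : L, x ∈ S ↔ spectralNorm ℚ_[l] L x ≤ 1 := fun x => by
    rw [hS, isIntegral_iff_spectralNorm_le_one]
  have hmul : ∀ x y : L, spectralNorm ℚ_[l] L (x * y)
      = spectralNorm ℚ_[l] L x * spectralNorm ℚ_[l] L y := fun x y => spectralAlgNorm_mul x y
  have hone : spectralNorm ℚ_[l] L (1 : L) = 1 := spectralNorm_one
  have key : ∀ a : S, a ∈ nonunits S ↔ spectralNorm ℚ_[l] L (a : L) < 1 := by
    intro a
    have ha := (hS' a).1 a.2
    constructor
    · intro hn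
      refine lt_of_le_of_ne ha fun h1 => hn ?_
      have h0 : (a : L) ≠ 0 := by
        intro h0
        rw [h0, spectralNorm_zero] at h1
        exact zero_ne_one h1
      have hinv : (a : L)⁻¹ ∈ S := by
        rw [hS']
        have := hmul a (a : L)⁻¹
        rw [mul_inv_cancel₀ h0, hone, h1, one_mul] at this
        exact this.symm.le
      exact IsUnit.of_mul_eq_one (⟨_, hinv⟩ : S) (Subtype.ext (mul_inv_cancel₀ h0))
    · intro hlt hu
      obtain ⟨b, hb⟩ := hu.exists_right_inv
      have hb1 := (hS' b).1 b.2
      have : (a : L) * (b : L) = 1 := congrArg Subtype.val hb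
      have h2 := hmul a b
      rw [this, hone] at h2
      have h3 := spectralNorm_nonneg (K := ℚ_[l]) (a : L)
      nlinarith
  refine IsLocalRing.of_nonunits_add fun a b ha hb => ?_
  rw [key] at ha hb ⊢
  exact lt_of_le_of_lt (isNonarchimedean_spectralNorm (a : L) (b : L)) (max_lt ha hb)

/-- The ring of integers `𝔬` of an extension `K` of `ℚ_l`. -/
noncomputable abbrev integers (l : ℕ) [Fact l.Prime] (K : Type*) [Field K] [Algebra ℤ_[l] K] :
    Subalgebra ℤ_[l] K :=
  integralClosure ℤ_[l] K

/-- The ring of integers `𝔬_L` of an extension `L` of `K`, as an algebra over `𝔬`. -/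
noncomputable abbrev integersExt (l : ℕ) [Fact l.Prime] (K L : Type*) [Field K] [Algebra ℤ_[l] K]
    [Field L] [Algebra K L] : Subalgebra (integers l K) L :=
  integralClosure (integers l K) L

instance isLocalRing_integers (l : ℕ) [Fact l.Prime] (K : Type*) [Field K] [Algebra ℚ_[l] K]
    [Algebra ℤ_[l] K] [IsScalarTower ℤ_[l] ℚ_[l] K] [Algebra.IsAlgebraic ℚ_[l] K] :
    IsLocalRing (integers l K) :=
  isLocalRing_of_mem_iff l _ fun _ => Iff.rfl

instance isLocalRing_integersExt (l : ℕ) [Fact l.Prime] (K L : Type*) [Field K]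
    [Algebra ℚ_[l] K] [Algebra ℤ_[l] K] [IsScalarTower ℤ_[l] ℚ_[l] K]
    [Algebra.IsAlgebraic ℚ_[l] K] [Field L] [Algebra K L] [Algebra.IsAlgebraic K L] :
    IsLocalRing (integersExt l K L) := by
  let _ : Algebra ℚ_[l] L := ((algebraMap K L).comp (algebraMap ℚ_[l] K)).toAlgebra
  let _ : Algebra ℤ_[l] L := ((algebraMap K L).comp (algebraMap ℤ_[l] K)).toAlgebra
  have : IsScalarTower ℚ_[l] K L := IsScalarTower.of_algebraMap_eq fun _ => rfl
  have : IsScalarTower ℤ_[l] K L := IsScalarTower.of_algebraMap_eq fun _ => rfl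
  have : IsScalarTower ℤ_[l] ℚ_[l] L := IsScalarTower.of_algebraMap_eq fun x => by
    change algebraMap K L (algebraMap ℤ_[l] K x) = algebraMap K L (algebraMap ℚ_[l] K _)
    rw [IsScalarTower.algebraMap_apply ℤ_[l] ℚ_[l] K]
  have : IsScalarTower ℤ_[l] (integers l K) L := IsScalarTower.of_algebraMap_eq fun _ => rfl
  have : Algebra.IsAlgebraic ℚ_[l] L := Algebra.IsAlgebraic.trans ℚ_[l] K L
  refine isLocalRing_of_mem_iff l _ fun x => ?_
  change IsIntegral (integers l K) x ↔ _
  exact ⟨fun h => isIntegral_trans x h, fun h => h.tower_top⟩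

/-! ### Numerical invariants of `K` -/

section Invariants

variable (l : ℕ) [Fact l.Prime] (K : Type*) [Field K] [Algebra ℚ_[l] K] [Algebra ℤ_[l] K]
  [IsScalarTower ℤ_[l] ℚ_[l] K] [Algebra.IsAlgebraic ℚ_[l] K]

/-- The ramification index `e` of `K` over `ℚ_l`. -/
noncomputable def absRamIdx : ℕ :=
  (IsLocalRing.maximalIdeal (integers l K)).ramificationIdx ℤ_[l]

/-- The residual degree `f` of `K` over `ℚ_l`. -/
noncomputable def absResDeg : ℕ :=
  (IsLocalRing.maximalIdeal (integers l K)).inertiaDeg ℤ_[l]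

/-- `e₁ = e / (l - 1)`. The division is exact as soon as `Kˣ` has an element of order `l`. -/
noncomputable def eOne : ℕ := absRamIdx l K / (l - 1)

/-- `μ(t) = (t - ⌊t / l⌋) f` for `t < l e₁`, and `μ(l e₁) = 1 + d` with `d = [K : ℚ_l]`. -/
noncomputable def mu (t : ℕ) : ℕ :=
  if t = l * eOne l K then 1 + Module.finrank ℚ_[l] K else (t - t / l) * absResDeg l K

/-- The `i`-th (`i = 1, 2, …`), in increasing order, of the integers in `[1, l e₁[` which are
prime to `l`. -/
noncomputable def tBreak (i : ℕ) : ℕ :=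
  Nat.nth (fun s => 1 ≤ s ∧ s < l * eOne l K ∧ s.Coprime l) (i - 1)

end Invariants

/-- `δ_l(n) = 1 + l + ⋯ + l ^ n`. -/
def delta (l n : ℕ) : ℕ := ∑ j ∈ Finset.range (n + 1), l ^ j

/-! ### Ramification filtration and discriminant of an extension -/

section Extension

variable (l : ℕ) [Fact l.Prime] (K : Type*) [Field K] [Algebra ℚ_[l] K] [Algebra ℤ_[l] K]
  [IsScalarTower ℤ_[l] ℚ_[l] K] [Algebra.IsAlgebraic ℚ_[l] K]
  (L : Type*) [Field L] [Algebra K L] [Algebra.IsAlgebraic K L]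

/-- The ramification group `G_n` (lower numbering, `n ≥ -1`) of `G = Gal(L|K)`: the automorphisms
which act trivially on `𝔬_L / 𝔩_L ^ (n + 1)`, where `𝔩_L` is the maximal ideal of `𝔬_L`. -/
def ramificationGroup (n : ℤ) : Subgroup (L ≃ₐ[K] L) where
  carrier := {σ | ∀ x : integersExt l K L,
    ∃ y ∈ IsLocalRing.maximalIdeal (integersExt l K L) ^ (n + 1).toNat,
      (y : L) = σ (x : L) - (x : L)}
  one_mem' x := ⟨0, zero_mem _, by simp⟩
  mul_mem' {σ τ} hσ hτ x := by
    have hτx : τ (x : L) ∈ integersExt l K L :=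
      IsIntegral.map (τ.toAlgHom.restrictScalars (integers l K)) x.2
    obtain ⟨y, hy, hy'⟩ := hσ ⟨_, hτx⟩
    obtain ⟨z, hz, hz'⟩ := hτ x
    refine ⟨y + z, add_mem hy hz, ?_⟩
    simp only [AlgEquiv.mul_apply]
    rw [show ((y + z : integersExt l K L) : L) = (y : L) + (z : L) from rfl, hy', hz']
    ring
  inv_mem' {σ} hσ x := by
    have hx : σ⁻¹ (x : L) ∈ integersExt l K L :=
      IsIntegral.map ((σ⁻¹).toAlgHom.restrictScalars (integers l K)) x.2
    obtain ⟨y, hy, hy'⟩ := hσ ⟨_, hx⟩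
    refine ⟨-y, neg_mem hy, ?_⟩
    have h1 : σ (σ⁻¹ (x : L)) = x := σ.apply_symm_apply (x : L)
    rw [show ((-y : integersExt l K L) : L) = -(y : L) from rfl, hy']
    simp only [h1]
    ring

/-- The ramification break of `L|K` occurs at `t`: `G_t = G` and `G_{t+1} = {Id_L}`. -/
def HasRamificationBreak (t : ℤ) : Prop :=
  ramificationGroup l K L t = ⊤ ∧ ramificationGroup l K L (t + 1) = ⊥

/-- The discriminant ideal `d_{L|K}` of `𝔬`, generated by the discriminants
`det (Tr (b_i b_j))` of all families of `[L : K]` elements of `𝔬_L`. -/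
noncomputable def discrIdeal : Ideal (integers l K) :=
  Ideal.span (Set.range fun b : Fin (Module.finrank K L) → integersExt l K L =>
    Algebra.discr (integers l K) b)

/-- The normalised valuation `v_K(d_{L|K})`: the exponent of the maximal ideal of `𝔬`
in the discriminant ideal. -/
noncomputable def discrVal : ℕ∞ :=
  emultiplicity (IsLocalRing.maximalIdeal (integers l K)) (discrIdeal l K L)

end Extension

/-! ### Kummerian extensions -/

/-- `L` (inside a fixed algebraic closure of `K`) is a degree-`l` kummerian extension of `K`, for
a prime `l` such that `K` contains a primitive `l`-th root of unity: `[L : K] = l` and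
`L = K(x)` for some `x` with `x ^ l ∈ K`. -/
def IsKummer (l : ℕ) {K : Type*} [Field K] (L : IntermediateField K (AlgebraicClosure K)) : Prop :=
  Module.finrank K L = l ∧
    ∃ x : AlgebraicClosure K, x ^ l ∈ Set.range (algebraMap K (AlgebraicClosure K)) ∧ L = K⟮x⟯

section Sets

variable (l : ℕ) [Fact l.Prime] (K : Type*) [Field K] [Algebra ℚ_[l] K] [Algebra ℤ_[l] K]
  [IsScalarTower ℤ_[l] ℚ_[l] K] [Algebra.IsAlgebraic ℚ_[l] K]

/-- The degree-`l` kummerian extensions of `K` whose ramification break occurs at `t`. -/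
def kummerWithBreak (t : ℕ) : Set (IntermediateField K (AlgebraicClosure K)) :=
  {L | IsKummer l L ∧ HasRamificationBreak l K L (t : ℤ)}

/-- The degree-`l` kummerian extensions `L` of `K` with `v_K(d_{L|K}) = n`. -/
def kummerWithDiscrVal (n : ℕ) : Set (IntermediateField K (AlgebraicClosure K)) :=
  {L | IsKummer l L ∧ discrVal l K L = (n : ℕ∞)}

end Sets

end LocalKummer

/-! Let |·| extend the `l`-adic absolute value, let ϖ be a uniformizer of `K`, ζ a primitive `l`-th
root of unity and c = |ζ - 1|. From l = ∏ (1 - ξ) over the roots ξ ≠ 1 comes |l| = c ^ (l - 1), so c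
= |ϖ| ^ m with m = e₁. By Kummer theory the extensions to be counted correspond to the subgroups of
order `l` (the lines) of V = Kˣ / (Kˣ) ^ l (`isKummer_iff`, `kummerField_eq_iff`). Filter V by V_0 =
V and, for n ≥ 1, by the images V_n of U_n = 1 + ϖ ^ n 𝔬.

Sizes. (1 + z) ^ l - 1 has size |z| ^ l when |z| > c and at most |l z| when |z| ≤ c, and every a
with |a - 1| < c ^ l is an `l`-th power. Hence, for 1 ≤ n ≤ l m, the `l`-th powers in U_n are those
of U_k with k = ⌈n / l⌉ (`powers_inf_unitFiltration`), and an index computation gives |V_(lm - t)| =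
l ^ (1 + μ(t)) (`card_quotientFiltration_sub`, `card_quotientFiltration_zero`).

Ramification. A line inside V_n but not inside V_(n+1), with n < l m, gives an extension with break
t = l m - n and discriminant valuation (l - 1)(1 + t) (`hasRamificationBreak_kummerField`); a line
inside V_(lm) gives an unramified one (`unramified_kummerField`).

So the extensions with break t ≥ 1 number (l ^ (1 + μ(t)) - l ^ (1 + μ(t - 1))) / (l - 1), which is
δ(μ(t)) - δ(μ(t - 1)). The count by discriminant is the same count at t = t_i, because t - ⌊t / l⌋
is the number of integers in [1, t] prime to `l`. -/

set_option linter.unusedSectionVars false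

namespace LocalKummer

/-! ### The `l`-th power map near 1 in a nonarchimedean field -/

section PowerMap

variable {E : Type*} [Field E] {v : AbsoluteValue E ℝ} (hv : IsNonarchimedean v)

include hv in
theorem sum_le_of_forall_le {ι : Type*} (s : Finset ι) (g : ι → E) {B : ℝ} (hB : 0 ≤ B)
    (h : ∀ i ∈ s, v (g i) ≤ B) : v (∑ i ∈ s, g i) ≤ B := by
  rcases s.eq_empty_or_nonempty with rfl | hs
  · simpa using hB
  · obtain ⟨b, hb, hle⟩ := hv.finset_image_add_of_nonempty g hs
    exact hle.trans (h b hb)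

include hv in
theorem absVal_sub_le (x y : E) : v (x - y) ≤ max (v x) (v y) := by
  have := hv x (-y)
  rwa [v.map_neg, ← sub_eq_add_neg] at this

/-- The terms of `(1 + z) ^ l - 1` other than `z ^ l`. -/
theorem one_add_pow_prime_sub_one (l : ℕ) [Fact l.Prime] (z : E) :
    (1 + z) ^ l - 1 = z ^ l +
      ∑ k ∈ Finset.Ioo 0 l, (l : E) * (z ^ k * ((l.choose k / l : ℕ) : E)) := by
  rw [add_comm 1 z, add_pow_prime_eq' (Fact.out : l.Prime), ← Finset.mul_sum]
  simp only [one_pow, mul_one]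
  ring

variable {l : ℕ} [Fact l.Prime] {c : ℝ} (hc : c < 1) (hl : v (l : E) = c ^ (l - 1))

include hv hl in
theorem one_add_pow_term_le (z : E) (k : ℕ) :
    v ((l : E) * (z ^ k * ((l.choose k / l : ℕ) : E))) ≤ c ^ (l - 1) * v z ^ k := by
  rw [map_mul, map_mul, map_pow, hl]
  have h1 : v ((l.choose k / l : ℕ) : E) ≤ 1 := hv.apply_natCast_le_one
  have h2 : 0 ≤ c ^ (l - 1) := hl ▸ v.nonneg _
  have h3 : 0 ≤ v z ^ k := pow_nonneg (v.nonneg _) _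
  calc c ^ (l - 1) * (v z ^ k * v ((l.choose k / l : ℕ) : E)) ≤ c ^ (l - 1) * (v z ^ k * 1) := by
        gcongr
    _ = _ := by rw [mul_one]

-- Above the threshold c the term z ^ l dominates: the k-th term is at most c ^ (l - 1) |z| ^ k ≤ c
-- ^ (l - k) |z| ^ k < |z| ^ l. In the applications c = |ζ - 1|.
include hv hl hc in
theorem absVal_one_add_pow_sub_one_of_lt (hc0 : 0 ≤ c) {z : E} (hz : c < v z) :
    v ((1 + z) ^ l - 1) = v z ^ l := by
  rw [one_add_pow_prime_sub_one]
  have hlp : l.Prime := Fact.out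
  have hz0 : 0 < v z := hc0.trans_lt hz
  rw [← map_pow]
  refine hv.add_eq_left_of_lt ?_
  have hne : (Finset.Ioo 0 l).Nonempty := ⟨1, by simpa using hlp.one_lt⟩
  obtain ⟨k, hk, hle⟩ := hv.finset_image_add_of_nonempty
    (fun k => (l : E) * (z ^ k * ((l.choose k / l : ℕ) : E))) hne
  refine hle.trans_lt ((one_add_pow_term_le hv hl z k).trans_lt ?_)
  rw [Finset.mem_Ioo] at hk
  have h1 : c ^ (l - 1) ≤ c ^ (l - k) := pow_le_pow_of_le_one hc0 hc.le (by omega)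
  have h2 : c ^ (l - k) < v z ^ (l - k) := pow_lt_pow_left₀ hz hc0 (by omega)
  have h3 : v (z ^ l) = v z ^ (l - k) * v z ^ k := by
    rw [map_pow, ← pow_add, Nat.sub_add_cancel hk.2.le]
  rw [h3]
  exact mul_lt_mul_of_pos_right (h1.trans_lt h2) (pow_pos hz0 _)

-- Below the threshold |z| ^ (l - 1) ≤ c ^ (l - 1) = |l|, so every term, z ^ l included, is bounded
-- by |l z|.
include hv hl hc in
theorem absVal_one_add_pow_sub_one_le {z : E} (hz : v z ≤ c) :
    v ((1 + z) ^ l - 1) ≤ c ^ (l - 1) * v z := by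
  have hlp : l.Prime := Fact.out
  have hz0 : 0 ≤ v z := v.nonneg _
  have hc0 : 0 ≤ c := hz0.trans hz
  rw [one_add_pow_prime_sub_one]
  refine (hv _ _).trans (max_le ?_ (sum_le_of_forall_le hv _ _ (by positivity) fun k hk => ?_))
  · rw [map_pow, ← Nat.sub_add_cancel hlp.one_lt.le, pow_succ, Nat.add_sub_cancel]
    gcongr
  · refine (one_add_pow_term_le hv hl z k).trans ?_
    have : v z ^ k ≤ v z :=
      pow_le_of_le_one hz0 (hz.trans hc.le) (Finset.mem_Ioo.1 hk).1.ne'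
    gcongr

end PowerMap

/-! ### Distances between `l`-th roots of unity -/

section RootsOfUnity

variable {E : Type*} [Field E] {v : AbsoluteValue E ℝ} (hv : IsNonarchimedean v)
  {l : ℕ} [Fact l.Prime] {ζ : E} (hζ : IsPrimitiveRoot ζ l)

include hζ in
theorem absVal_root_eq_one : v ζ = 1 := by
  have h : v ζ ^ l = 1 := by rw [← map_pow, hζ.pow_eq_one, map_one]
  exact (pow_eq_one_iff_of_nonneg (v.nonneg _) (Fact.out : l.Prime).ne_zero).1 h

-- ξ is a power of ζ, so ξ - 1 is ζ - 1 times a geometric sum of absolute value at most 1. When ξ is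
-- primitive too, exchanging the two roots gives equality.
include hv hζ in
theorem absVal_root_sub_one_le_of_primitive {ξ : E} (hξ : ξ ^ l = 1) :
    v (ξ - 1) ≤ v (ζ - 1) := by
  have : NeZero l := ⟨(Fact.out : l.Prime).ne_zero⟩
  obtain ⟨i, -, rfl⟩ := hζ.eq_pow_of_pow_eq_one hξ
  rw [← mul_geom_sum, map_mul]
  have : v (∑ j ∈ Finset.range i, ζ ^ j) ≤ 1 :=
    sum_le_of_forall_le hv _ _ zero_le_one fun j _ => by
      rw [map_pow, absVal_root_eq_one hζ, one_pow]
  exact mul_le_of_le_one_right (v.nonneg _) this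

include hv hζ in
theorem absVal_root_sub_one {ξ : E} (hξ : ξ ^ l = 1) (h1 : ξ ≠ 1) :
    v (ξ - 1) = v (ζ - 1) := by
  have hξ' : IsPrimitiveRoot ξ l :=
    IsPrimitiveRoot.iff_orderOf.2 (orderOf_eq_prime hξ h1)
  exact le_antisymm (absVal_root_sub_one_le_of_primitive hv hζ hξ)
    (absVal_root_sub_one_le_of_primitive hv hξ' hζ.pow_eq_one)

-- Evaluating the cyclotomic polynomial at 1 writes `l` as the product of the l - 1 factors 1 - ξ,
-- all of the same absolute value.
include hv hζ in
theorem absVal_prime_eq : v (l : E) = v (ζ - 1) ^ (l - 1) := by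
  have hlp : l.Prime := Fact.out
  have h := Polynomial.eval_one_cyclotomic_prime (R := E) (p := l)
  rw [Polynomial.cyclotomic_eq_prod_X_sub_primitiveRoots hζ, Polynomial.eval_prod] at h
  rw [← h, map_prod]
  rw [Finset.prod_congr rfl (g := fun _ => v (ζ - 1)), Finset.prod_const,
    hζ.card_primitiveRoots, Nat.totient_prime hlp]
  intro ξ hξ
  have hξ' := isPrimitiveRoot_of_mem_primitiveRoots hξ
  rw [Polynomial.eval_sub, Polynomial.eval_X, Polynomial.eval_C, v.map_sub]
  exact absVal_root_sub_one hv hζ hξ'.pow_eq_one (hξ'.ne_one hlp.one_lt)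

end RootsOfUnity

/-! ### The absolute value of an algebraic extension of `ℚ_[l]` -/

section AbsVal

variable (l : ℕ) [Fact l.Prime] (E : Type*) [Field E] [Algebra ℚ_[l] E]
  [Algebra.IsAlgebraic ℚ_[l] E]

/-- The absolute value of an algebraic extension of `ℚ_l` which extends that of `ℚ_l`. -/
noncomputable def absVal : AbsoluteValue E ℝ where
  toFun := spectralNorm ℚ_[l] E
  map_mul' x y := spectralAlgNorm_mul x y
  nonneg' := spectralNorm_nonneg
  eq_zero' x := ⟨fun h => eq_zero_of_map_spectralNorm_eq_zero h (Algebra.IsAlgebraic.isAlgebraic x),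
    fun h => by rw [h, spectralNorm_zero]⟩
  add_le' _ _ := isNonarchimedean_spectralNorm.add_le spectralNorm_nonneg

theorem absVal_apply (x : E) : absVal l E x = spectralNorm ℚ_[l] E x := rfl

theorem isNonarchimedean_absVal : IsNonarchimedean (absVal l E) :=
  fun x y => isNonarchimedean_spectralNorm x y

theorem absVal_prime : absVal l E (l : E) = (l : ℝ)⁻¹ := by
  rw [absVal_apply, ← map_natCast (algebraMap ℚ_[l] E), spectralNorm_extends, Padic.norm_p]

theorem absVal_algebraMap (F : Type*) [Field F] [Algebra ℚ_[l] F] [Algebra.IsAlgebraic ℚ_[l] F]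
    [Algebra E F] [IsScalarTower ℚ_[l] E F] (x : E) :
    absVal l F (algebraMap E F x) = absVal l E x :=
  (spectralNorm.eq_of_tower x).symm

variable {l E} in
theorem absVal_algEquiv {K : Type*} [Field K] [Algebra ℚ_[l] K] [Algebra K E]
    [IsScalarTower ℚ_[l] K E] (σ : E ≃ₐ[K] E) (x : E) : absVal l E (σ x) = absVal l E x :=
  (spectralNorm_eq_of_equiv (σ.restrictScalars ℚ_[l]) x).symm

end AbsVal

end LocalKummer

namespace LocalKummer

/-! ### The ring of integers of `K`, its residue field and uniformizers -/

section Integers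

variable (l : ℕ) [Fact l.Prime] (K : Type*) [Field K] [Algebra ℚ_[l] K] [Algebra ℤ_[l] K]
  [IsScalarTower ℤ_[l] ℚ_[l] K]

section Algebraic

variable [Algebra.IsAlgebraic ℚ_[l] K]

theorem mem_integers_iff {x : K} : x ∈ integers l K ↔ absVal l K x ≤ 1 :=
  isIntegral_iff_spectralNorm_le_one l K x

theorem isUnit_integers_iff (x : integers l K) : IsUnit x ↔ absVal l K x = 1 := by
  constructor
  · rintro h
    obtain ⟨y, hy⟩ := h.exists_right_inv
    have h1 := (mem_integers_iff l K).1 x.2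
    have h2 := (mem_integers_iff l K).1 y.2
    have h3 : absVal l K x * absVal l K y = 1 := by
      rw [← map_mul, ← MulMemClass.coe_mul, hy, OneMemClass.coe_one, map_one]
    nlinarith [(absVal l K).nonneg x]
  · intro h
    have h0 : (x : K) ≠ 0 := by
      intro h0
      rw [h0, map_zero] at h
      exact zero_ne_one h
    have hinv : (x : K)⁻¹ ∈ integers l K := by
      rw [mem_integers_iff, map_inv₀, h, inv_one]
    exact IsUnit.of_mul_eq_one (⟨_, hinv⟩ : integers l K) (Subtype.ext (mul_inv_cancel₀ h0))

theorem mem_maximalIdeal_integers_iff (x : integers l K) :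
    x ∈ IsLocalRing.maximalIdeal (integers l K) ↔ absVal l K x < 1 := by
  rw [IsLocalRing.mem_maximalIdeal, mem_nonunits_iff, isUnit_integers_iff]
  exact ⟨fun h => lt_of_le_of_ne ((mem_integers_iff l K).1 x.2) h, fun h => h.ne⟩

end Algebraic

variable [FiniteDimensional ℚ_[l] K]

instance isTorsionFree_integers : Module.IsTorsionFree ℤ_[l] (integers l K) := by
  have h : Function.Injective (algebraMap ℤ_[l] K) := by
    rw [IsScalarTower.algebraMap_eq ℤ_[l] ℚ_[l] K]
    exact (algebraMap ℚ_[l] K).injective.comp (IsFractionRing.injective ℤ_[l] ℚ_[l])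
  have h' : Function.Injective (algebraMap ℤ_[l] (integers l K)) := fun x y hxy =>
    h (congrArg Subtype.val hxy)
  exact Module.isTorsionFree_iff_algebraMap_injective.2 h'

instance moduleFinite_integers : Module.Finite ℤ_[l] (integers l K) :=
  IsIntegralClosure.finite ℤ_[l] ℚ_[l] K (integers l K)

instance isDiscreteValuationRing_integers : IsDiscreteValuationRing (integers l K) := by
  have : IsDedekindDomain (integers l K) := integralClosure.isDedekindDomain ℤ_[l] ℚ_[l] K
  have h : ¬ IsField (integers l K) := by
    intro h
    have hl : (l : integers l K) ≠ 0 := by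
      intro h0
      have : (l : K) = 0 := by simpa using congrArg Subtype.val h0
      have h1 := absVal_prime l K
      rw [this, map_zero] at h1
      exact (inv_ne_zero (Nat.cast_ne_zero.2 (Fact.out : l.Prime).ne_zero)) h1.symm
    obtain ⟨y, hy⟩ := h.mul_inv_cancel hl
    have := (isUnit_integers_iff l K _).1 (IsUnit.of_mul_eq_one _ hy)
    have h2 : absVal l K ((l : integers l K) : K) = (l : ℝ)⁻¹ := by
      simpa using absVal_prime l K
    rw [h2, inv_eq_one] at this
    exact (Fact.out : l.Prime).one_lt.ne' (by exact_mod_cast this)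
  exact ((IsDiscreteValuationRing.TFAE (integers l K) h).out 0 2).2 this

instance liesOver_maximalIdeal_integers :
    (IsLocalRing.maximalIdeal (integers l K)).LiesOver (IsLocalRing.maximalIdeal ℤ_[l]) :=
  ⟨(IsLocalRing.eq_maximalIdeal (Ideal.isMaximal_comap_of_isIntegral_of_isMaximal
    (IsLocalRing.maximalIdeal (integers l K)))).symm⟩

theorem absRamIdx_mul_absResDeg : absRamIdx l K * absResDeg l K = Module.finrank ℚ_[l] K := by
  have hp : IsLocalRing.maximalIdeal ℤ_[l] ≠ ⊥ := IsDiscreteValuationRing.not_a_field _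
  have : IsFractionRing (integers l K) K :=
    integralClosure.isFractionRing_of_finite_extension ℚ_[l] K
  rw [absRamIdx, absResDeg, ← Ideal.inertiaDeg'_eq_inertiaDeg (IsLocalRing.maximalIdeal ℤ_[l]),
    ← Ideal.ramificationIdx'_eq_ramificationIdx (IsLocalRing.maximalIdeal ℤ_[l]) _ hp]
  exact Ideal.ramificationIdx_mul_inertiaDeg_of_isLocalRing (integers l K) ℚ_[l] K hp

theorem card_residueField_integers :
    Nat.card (integers l K ⧸ IsLocalRing.maximalIdeal (integers l K)) = l ^ absResDeg l K := by
  have h := Ideal.cardQuot_pow_inertiaDeg (IsLocalRing.maximalIdeal ℤ_[l])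
    (IsLocalRing.maximalIdeal (integers l K))
  have h2 : (IsLocalRing.maximalIdeal ℤ_[l]).cardQuot = l := by
    rw [Submodule.cardQuot_apply]
    exact (Nat.card_congr (PadicInt.residueField (p := l)).toEquiv).trans (Nat.card_zmod l)
  rw [h2] at h
  exact h.symm

/-- `ϖ` is a uniformizer of `K`. -/
def IsUniformizer (ϖ : K) : Prop :=
  0 < absVal l K ϖ ∧ absVal l K ϖ < 1 ∧
    ∀ x : K, x ≠ 0 → ∃ k : ℤ, absVal l K x = absVal l K ϖ ^ k

/-- The second clause is how the ramification index, defined through ideals, enters the arguments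
with absolute values: l 𝔬 is the e-th power of the maximal ideal. -/
theorem exists_isUniformizer : ∃ ϖ : K, IsUniformizer l K ϖ ∧
    absVal l K (l : K) = absVal l K ϖ ^ absRamIdx l K := by
  obtain ⟨p, hp⟩ := IsDiscreteValuationRing.exists_irreducible (integers l K)
  have hpm := hp.maximalIdeal_eq
  have hp0 : (p : K) ≠ 0 := fun h => hp.ne_zero (Subtype.ext h)
  have hunit : ∀ u : (integers l K)ˣ, absVal l K ((u : integers l K) : K) = 1 :=
    fun u => (isUnit_integers_iff l K _).1 u.isUnit
  have hint : ∀ x : integers l K, x ≠ 0 → ∃ k : ℕ, absVal l K x = absVal l K p ^ k := by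
    intro x hx
    obtain ⟨n, u, hu⟩ := IsDiscreteValuationRing.eq_unit_mul_pow_irreducible hx hp
    refine ⟨n, ?_⟩
    rw [hu]
    simp [hunit]
  refine ⟨p, ⟨(absVal l K).pos hp0, (mem_maximalIdeal_integers_iff l K p).1
    (hpm ▸ Ideal.mem_span_singleton_self p), fun x hx => ?_⟩, ?_⟩
  · by_cases h : absVal l K x ≤ 1
    · obtain ⟨k, hk⟩ := hint ⟨x, (mem_integers_iff l K).2 h⟩ (fun h => hx (congrArg Subtype.val h))
      exact ⟨k, by simpa using hk⟩
    · have h' : x⁻¹ ∈ integers l K := by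
        rw [mem_integers_iff, map_inv₀]
        exact inv_le_one_of_one_le₀ (not_le.1 h).le
      obtain ⟨k, hk⟩ := hint ⟨x⁻¹, h'⟩ (fun h => inv_ne_zero hx (congrArg Subtype.val h))
      refine ⟨-k, ?_⟩
      rw [zpow_neg, zpow_natCast, ← hk, map_inv₀, inv_inv]
  · have hpl : IsLocalRing.maximalIdeal ℤ_[l] ≠ ⊥ := IsDiscreteValuationRing.not_a_field _
    have hmap : (IsLocalRing.maximalIdeal ℤ_[l]).map (algebraMap ℤ_[l] (integers l K)) ≠ ⊥ :=
      Ideal.map_ne_bot_of_ne_bot hpl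
    have hl0 : (l : integers l K) ≠ 0 := by
      intro h0
      apply hmap
      rw [PadicInt.maximalIdeal_eq_span_p, Ideal.map_span, Set.image_singleton, map_natCast, h0]
      simp
    obtain ⟨n, u, hu⟩ := IsDiscreteValuationRing.eq_unit_mul_pow_irreducible hl0 hp
    have hn : absRamIdx l K = n := by
      rw [absRamIdx, ← Ideal.ramificationIdx'_eq_ramificationIdx (IsLocalRing.maximalIdeal ℤ_[l])
        _ hpl]
      have hmap' : (IsLocalRing.maximalIdeal ℤ_[l]).map (algebraMap ℤ_[l] (integers l K)) =
          IsLocalRing.maximalIdeal (integers l K) ^ n := by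
        rw [PadicInt.maximalIdeal_eq_span_p, Ideal.map_span, Set.image_singleton, map_natCast, hu,
          Ideal.span_singleton_mul_left_unit u.isUnit, hpm, Ideal.span_singleton_pow]
      refine Ideal.ramificationIdx'_spec hmap'.le ?_
      rw [hmap']
      intro h
      have h1 := Ideal.pow_succ_lt_pow (IsDiscreteValuationRing.not_a_field (integers l K)) n
      exact absurd h h1.not_ge
    rw [hn]
    have : ((l : integers l K) : K) = l := by simp
    rw [← this, hu]
    simp [hunit]

end Integers

end LocalKummer

/-! ### Higher unit groups and their successive quotients -/

namespace LocalKummer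

theorem zpow_le_pow_iff {r : ℝ} (h0 : 0 < r) (h1 : r < 1) (k : ℤ) (n : ℕ) :
    r ^ k ≤ r ^ n ↔ (n : ℤ) ≤ k := by
  rw [← zpow_natCast, zpow_le_zpow_iff_right_of_lt_one₀ h0 h1]

section Units

variable (l : ℕ) [Fact l.Prime] (K : Type*) [Field K] [Algebra ℚ_[l] K]
  [Algebra.IsAlgebraic ℚ_[l] K]

/-- The group of units `u` of `K` such that `u - 1` has absolute value at most `|ϖ| ^ n`. -/
def unitFiltration (ϖ : K) (n : ℕ) : Subgroup Kˣ where
  carrier := {u | absVal l K (u : K) = 1 ∧ absVal l K ((u : K) - 1) ≤ absVal l K ϖ ^ n}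
  one_mem' := by
    refine ⟨by simp, ?_⟩
    simp [pow_nonneg ((absVal l K).nonneg ϖ) n]
  mul_mem' {a b} ha hb := by
    refine ⟨by simp [ha.1, hb.1], ?_⟩
    have : ((a * b : Kˣ) : K) - 1 = (a : K) * ((b : K) - 1) + ((a : K) - 1) := by
      push_cast
      ring
    rw [this]
    refine (isNonarchimedean_absVal l K _ _).trans (max_le ?_ ha.2)
    rw [map_mul, ha.1, one_mul]
    exact hb.2
  inv_mem' {a} ha := by
    refine ⟨by simp [ha.1], ?_⟩
    have : ((a⁻¹ : Kˣ) : K) - 1 = -((a⁻¹ : Kˣ) : K) * ((a : K) - 1) := by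
      have : ((a⁻¹ : Kˣ) : K) * (a : K) = 1 := by simp
      linear_combination this
    rw [this, map_mul, AbsoluteValue.map_neg]
    simpa [ha.1] using ha.2

variable {l K}

theorem mem_unitFiltration {ϖ : K} {n : ℕ} {u : Kˣ} : u ∈ unitFiltration l K ϖ n ↔
    absVal l K (u : K) = 1 ∧ absVal l K ((u : K) - 1) ≤ absVal l K ϖ ^ n := Iff.rfl

theorem unitFiltration_antitone {ϖ : K} (h : absVal l K ϖ ≤ 1) :
    Antitone (unitFiltration l K ϖ) := fun _ _ hmn _ hu =>
  ⟨hu.1, hu.2.trans (pow_le_pow_of_le_one ((absVal l K).nonneg _) h hmn)⟩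

theorem absVal_eq_one_of_sub_one_lt {x : K} (hx : absVal l K (x - 1) < 1) : absVal l K x = 1 := by
  have h : absVal l K (x - 1 + 1) = absVal l K 1 :=
    (isNonarchimedean_absVal l K).add_eq_right_of_lt (by rwa [map_one])
  rwa [sub_add_cancel, map_one] at h

theorem mem_unitFiltration_of_pos {ϖ : K} (h1 : absVal l K ϖ < 1) {n : ℕ} (hn : 1 ≤ n) {u : Kˣ} :
    u ∈ unitFiltration l K ϖ n ↔ absVal l K ((u : K) - 1) ≤ absVal l K ϖ ^ n := by
  rw [mem_unitFiltration, and_iff_right_iff_imp]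
  intro h
  exact absVal_eq_one_of_sub_one_lt
    (h.trans_lt (pow_lt_one₀ ((absVal l K).nonneg _) h1 (Nat.one_le_iff_ne_zero.1 hn)))

end Units

section Index

variable {l : ℕ} [Fact l.Prime] {K : Type*} [Field K] [Algebra ℚ_[l] K] [Algebra ℤ_[l] K]
  [IsScalarTower ℤ_[l] ℚ_[l] K] [FiniteDimensional ℚ_[l] K] {ϖ : K} (hϖ : IsUniformizer l K ϖ)

include hϖ in
theorem unitFiltration_sub_one_div_mem {n : ℕ} (u : unitFiltration l K ϖ n) :
    (((u : Kˣ) : K) - 1) / ϖ ^ n ∈ integers l K := by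
  rw [mem_integers_iff, map_div₀, map_pow]
  exact div_le_one_of_le₀ u.2.2 (pow_nonneg ((absVal l K).nonneg _) _)

/-- The homomorphism `u ↦ (u - 1) / ϖ ^ n` from the `n`-th unit group to the residue field. -/
noncomputable def unitFiltrationToResidue (hϖ : IsUniformizer l K ϖ) {n : ℕ} (hn : 1 ≤ n) :
    unitFiltration l K ϖ n →*
      Multiplicative (integers l K ⧸ IsLocalRing.maximalIdeal (integers l K)) :=
  MonoidHom.mk' (fun u => Multiplicative.ofAdd (Ideal.Quotient.mk _
    (⟨_, unitFiltration_sub_one_div_mem hϖ u⟩ : integers l K))) fun a b => by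
    rw [← ofAdd_add, ← map_add]
    congr 1
    rw [Ideal.Quotient.eq, mem_maximalIdeal_integers_iff]
    have h0 : ϖ ≠ 0 := (absVal l K).pos_iff.1 hϖ.1
    -- The defect of additivity comes from ab - 1 = (a - 1) + (b - 1) + (a - 1)(b - 1). It vanishes
    -- in the residue field because n ≥ 1 makes b - 1 topologically nilpotent.
    have : (((⟨_, unitFiltration_sub_one_div_mem hϖ (a * b)⟩ : integers l K) -
        ((⟨_, unitFiltration_sub_one_div_mem hϖ a⟩ : integers l K) +
        (⟨_, unitFiltration_sub_one_div_mem hϖ b⟩ : integers l K)) : integers l K) : K) =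
        ((((a : Kˣ) : K) - 1) / ϖ ^ n) * (((b : Kˣ) : K) - 1) := by
      push_cast
      field_simp
      ring
    rw [this, map_mul]
    have h1 := (mem_integers_iff l K).1 (unitFiltration_sub_one_div_mem hϖ a)
    have h2 : absVal l K (((b : Kˣ) : K) - 1) < 1 := b.2.2.trans_lt
      (pow_lt_one₀ ((absVal l K).nonneg _) hϖ.2.1 (Nat.one_le_iff_ne_zero.1 hn))
    nlinarith [(absVal l K).nonneg (((b : Kˣ) : K) - 1)]

theorem unitFiltrationToResidue_surjective {n : ℕ} (hn : 1 ≤ n) :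
    Function.Surjective (unitFiltrationToResidue hϖ hn) := by
  intro y
  obtain ⟨x, hx⟩ := Ideal.Quotient.mk_surjective y.toAdd
  have h0 : ϖ ≠ 0 := (absVal l K).pos_iff.1 hϖ.1
  have hlt : absVal l K (ϖ ^ n * x) ≤ absVal l K ϖ ^ n := by
    rw [map_mul, map_pow]
    exact mul_le_of_le_one_right (pow_nonneg ((absVal l K).nonneg _) _)
      ((mem_integers_iff l K).1 x.2)
  have hone : absVal l K (1 + ϖ ^ n * x) = 1 := by
    apply absVal_eq_one_of_sub_one_lt
    rw [add_sub_cancel_left]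
    exact hlt.trans_lt
      (pow_lt_one₀ ((absVal l K).nonneg _) hϖ.2.1 (Nat.one_le_iff_ne_zero.1 hn))
  have hne : (1 + ϖ ^ n * x : K) ≠ 0 := (absVal l K).pos_iff.1 (by rw [hone]; exact one_pos)
  refine ⟨⟨Units.mk0 _ hne, hone, by simpa using hlt⟩, ?_⟩
  apply Multiplicative.toAdd.injective
  rw [← hx]
  change Ideal.Quotient.mk _ _ = _
  congr 1
  apply Subtype.ext
  simp only [Units.val_mk0]
  field_simp
  ring

theorem unitFiltrationToResidue_ker {n : ℕ} (hn : 1 ≤ n) :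
    (unitFiltrationToResidue hϖ hn).ker =
      (unitFiltration l K ϖ (n + 1)).subgroupOf (unitFiltration l K ϖ n) := by
  ext u
  rw [MonoidHom.mem_ker, Subgroup.mem_subgroupOf,
    mem_unitFiltration_of_pos hϖ.2.1 (Nat.le_add_left 1 n)]
  have : unitFiltrationToResidue hϖ hn u = 1 ↔ Ideal.Quotient.mk
    (IsLocalRing.maximalIdeal (integers l K))
      ⟨_, unitFiltration_sub_one_div_mem hϖ u⟩ = 0 := Iff.rfl
  rw [this, Ideal.Quotient.eq_zero_iff_mem, mem_maximalIdeal_integers_iff]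
  simp only
  rw [map_div₀, map_pow, div_lt_one (pow_pos hϖ.1 n)]
  by_cases hu : ((u : Kˣ) : K) - 1 = 0
  · rw [hu, map_zero]
    exact iff_of_true (pow_pos hϖ.1 n) (pow_pos hϖ.1 _).le
  obtain ⟨k, hk⟩ := hϖ.2.2 _ hu
  rw [hk, zpow_le_pow_iff hϖ.1 hϖ.2.1, ← zpow_natCast,
    zpow_lt_zpow_iff_right_of_lt_one₀ hϖ.1 hϖ.2.1]
  push_cast
  omega

include hϖ in
theorem relIndex_unitFiltration_succ {n : ℕ} (hn : 1 ≤ n) :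
    (unitFiltration l K ϖ (n + 1)).relIndex (unitFiltration l K ϖ n) = l ^ absResDeg l K := by
  rw [Subgroup.relIndex, ← unitFiltrationToResidue_ker hϖ hn, Subgroup.index_ker,
    MonoidHom.range_eq_top.2 (unitFiltrationToResidue_surjective hϖ hn), Subgroup.card_top,
    ← card_residueField_integers l K]
  rfl

include hϖ in
theorem relIndex_unitFiltration {a b : ℕ} (ha : 1 ≤ a) (hab : a ≤ b) :
    (unitFiltration l K ϖ b).relIndex (unitFiltration l K ϖ a) =
      (l ^ absResDeg l K) ^ (b - a) := by
  induction b, hab using Nat.le_induction with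
  | base => simp
  | succ b hab ih =>
    have hanti := unitFiltration_antitone hϖ.2.1.le
    rw [← Subgroup.relIndex_mul_relIndex _ _ _ (hanti (Nat.le_succ b)) (hanti hab), ih,
      relIndex_unitFiltration_succ hϖ (ha.trans hab), Nat.succ_sub hab, pow_succ, mul_comm]

include hϖ in
/-- A unit of `𝔬` is the product of an `l`-th power and a unit congruent to `1`. -/
theorem exists_pow_mul_mem_unitFiltration_one {u : Kˣ} (hu : absVal l K (u : K) = 1) :
    ∃ y : Kˣ, u * (y ^ l)⁻¹ ∈ unitFiltration l K ϖ 1 := by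
  have hlp : l.Prime := Fact.out
  have hcard := card_residueField_integers l K
  let F := integers l K ⧸ IsLocalRing.maximalIdeal (integers l K)
  let _ : Field F := Ideal.Quotient.field _
  have hf : absResDeg l K ≠ 0 := (Ideal.inertiaDeg_pos _ _).ne'
  have : Finite F := Nat.finite_of_card_ne_zero (hcard ▸ pow_ne_zero _ hlp.ne_zero)
  have : Fintype F := Fintype.ofFinite F
  let x : integers l K := ⟨u, (mem_integers_iff l K).2 hu.le⟩
  have h := FiniteField.pow_card (Ideal.Quotient.mk (IsLocalRing.maximalIdeal (integers l K)) x : F)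
  rw [← Nat.card_eq_fintype_card, hcard, ← map_pow, Ideal.Quotient.eq,
    mem_maximalIdeal_integers_iff] at h
  -- With q = l ^ f the size of the residue field, the witness is u ^ (q / l), whose `l`-th power u
  -- ^ q is congruent to u.
  refine ⟨u ^ (l ^ (absResDeg l K - 1)), ?_⟩
  rw [← pow_mul, ← pow_succ, Nat.sub_add_cancel (Nat.one_le_iff_ne_zero.2 hf)]
  rw [mem_unitFiltration_of_pos hϖ.2.1 le_rfl, pow_one]
  have hu0 : (u : K) ≠ 0 := u.ne_zero
  have h2 : ((u * (u ^ l ^ absResDeg l K)⁻¹ : Kˣ) : K) - 1 =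
      -((u : K) ^ l ^ absResDeg l K - u) / (u : K) ^ l ^ absResDeg l K := by
    push_cast
    field_simp
    ring
  rw [h2, map_div₀, map_pow, hu, one_pow, div_one, AbsoluteValue.map_neg]
  have h3 : absVal l K ((u : K) ^ l ^ absResDeg l K - u) < 1 := by simpa [x] using h
  by_cases h0 : (u : K) ^ l ^ absResDeg l K - u = 0
  · rw [h0, map_zero]
    exact hϖ.1.le
  obtain ⟨k, hk⟩ := hϖ.2.2 _ h0
  rw [hk] at h3 ⊢
  have := (zpow_lt_zpow_iff_right_of_lt_one₀ hϖ.1 hϖ.2.1 (m := k) (n := 0)).1 (by simpa using h3)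
  have h4 := (zpow_le_pow_iff hϖ.1 hϖ.2.1 k 1).2 (by push_cast; omega)
  simpa using h4

end Index

end LocalKummer

namespace LocalKummer

/-! ### Elements close to 1 are `l`-th powers -/

section AlgebraicClosure

variable (l : ℕ) [Fact l.Prime] (K : Type*) [Field K] [Algebra ℚ_[l] K]
  [Algebra.IsAlgebraic ℚ_[l] K]

instance isAlgebraic_algebraicClosure : Algebra.IsAlgebraic ℚ_[l] (AlgebraicClosure K) :=
  Algebra.IsAlgebraic.trans ℚ_[l] K (AlgebraicClosure K)

include l in
theorem isGalois_algebraicClosure : IsGalois K (AlgebraicClosure K) := by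
  have : CharZero K := charZero_of_injective_algebraMap (algebraMap ℚ_[l] K).injective
  infer_instance

variable {l K}

/-- An element of `K` sufficiently close to `1` is an `l`-th power. -/
theorem exists_pow_eq_of_absVal_sub_one_lt {ζ : K} (hζ : IsPrimitiveRoot ζ l) {a : K}
    (ha : absVal l K (a - 1) < absVal l K (ζ - 1) ^ l) :
    ∃ y : K, y ^ l = a ∧ absVal l K (y - 1) < absVal l K (ζ - 1) := by
  have hlp : l.Prime := Fact.out
  have := isGalois_algebraicClosure l K
  let Ω := AlgebraicClosure K
  have hmap : ∀ x : K, absVal l Ω (algebraMap K Ω x) = absVal l K x := absVal_algebraMap l K Ω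
  have hζΩ : IsPrimitiveRoot (algebraMap K Ω ζ) l := hζ.map_of_injective (algebraMap K Ω).injective
  have hc : absVal l Ω (algebraMap K Ω ζ - 1) = absVal l K (ζ - 1) := by
    rw [← hmap, (algebraMap K Ω).map_sub, map_one]
  obtain ⟨α, hα⟩ := IsAlgClosed.exists_pow_nat_eq (algebraMap K Ω a) hlp.pos
  -- 1 - a is the product of the 1 - β over the `l` roots β of a. If each factor had size at least c
  -- = |ζ - 1|, then |a - 1| ≥ c ^ l, contrary to `ha`.
  have hprod := congrArg (Polynomial.eval 1)
    (X_pow_sub_C_eq_prod hζΩ hlp.pos hα)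
  simp only [Polynomial.eval_sub, Polynomial.eval_pow, Polynomial.eval_X, one_pow,
    Polynomial.eval_C, Polynomial.eval_prod] at hprod
  have hprod' := congrArg (absVal l Ω) hprod
  rw [map_prod, ← map_one (algebraMap K Ω), ← map_sub, hmap, AbsoluteValue.map_sub] at hprod'
  obtain ⟨i, -, hi⟩ : ∃ i ∈ Finset.range l, absVal l Ω (1 - algebraMap K Ω ζ ^ i * α) <
      absVal l K (ζ - 1) := by
    by_contra! h
    have h1 := Finset.prod_le_prod (s := Finset.range l) (fun _ _ => (absVal l K).nonneg (ζ - 1)) h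
    rw [Finset.prod_const, Finset.card_range] at h1
    rw [map_one] at hprod'
    exact absurd (h1.trans hprod'.ge) (not_le.2 ha)
  set β := algebraMap K Ω ζ ^ i * α with hβ
  have hβl : β ^ l = algebraMap K Ω a := by
    rw [hβ, mul_pow, hα, ← pow_mul, mul_comm i, pow_mul, hζΩ.pow_eq_one, one_pow, one_mul]
  have hβ1 : absVal l Ω (β - 1) < absVal l K (ζ - 1) := by rwa [AbsoluteValue.map_sub]
  have hζ1 : absVal l K (ζ - 1) ≤ 1 := by
    refine (absVal_sub_le (isNonarchimedean_absVal l K) _ _).trans ?_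
    rw [absVal_root_eq_one hζ, map_one, max_self]
  have hβone : absVal l Ω β = 1 := absVal_eq_one_of_sub_one_lt (hβ1.trans_le hζ1)
  have hβ0 : β ≠ 0 := (absVal l Ω).pos_iff.1 (by rw [hβone]; exact one_pos)
  -- Krasner's argument: a conjugate σ β ≠ β differs from β by a nontrivial root of unity, hence
  -- lies at distance c, whereas |σ β - β| ≤ |β - 1| < c. So β lies in `K`.
  obtain ⟨y, hy⟩ := (InfiniteGalois.mem_range_algebraMap_iff_fixed β).2 fun σ => by
    by_contra hne
    have hξ : (σ β / β) ^ l = 1 := by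
      rw [div_pow, ← map_pow, hβl, AlgEquiv.commutes, div_self]
      rw [← hβl]
      exact pow_ne_zero _ hβ0
    have hξ1 : σ β / β ≠ 1 := fun h => hne ((div_eq_one_iff_eq hβ0).1 h)
    have h := absVal_root_sub_one (isNonarchimedean_absVal l Ω) hζΩ hξ hξ1
    rw [hc, div_sub_one hβ0, map_div₀, hβone, div_one] at h
    have h2 : σ β - β = σ (β - 1) - (β - 1) := by
      rw [map_sub, map_one]
      ring
    rw [h2] at h
    have h3 := absVal_sub_le (isNonarchimedean_absVal l Ω) (σ (β - 1)) (β - 1)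
    rw [absVal_algEquiv, max_self, h] at h3
    exact absurd hβ1 (not_lt.2 h3)
  refine ⟨y, (algebraMap K Ω).injective ?_, ?_⟩
  · rw [map_pow, hy, hβl]
  · rw [← hmap, map_sub, hy, map_one]
    exact hβ1

end AlgebraicClosure

/-- The subgroup of `l`-th powers. -/
abbrev powers (l : ℕ) (K : Type*) [Field K] : Subgroup Kˣ := (powMonoidHom l : Kˣ →* Kˣ).range

theorem card_ker_powMonoidHom {l : ℕ} [Fact l.Prime] {K : Type*} [Field K] {ζ : K}
    (hζ : IsPrimitiveRoot ζ l) : Nat.card (powMonoidHom l : Kˣ →* Kˣ).ker = l := by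
  have : NeZero l := ⟨(Fact.out : l.Prime).ne_zero⟩
  have h : (powMonoidHom l : Kˣ →* Kˣ).ker = rootsOfUnity l K := by
    ext x
    rw [MonoidHom.mem_ker, mem_rootsOfUnity, powMonoidHom_apply]
  rw [h, hζ.card_rootsOfUnity]

/-! ### The index of the `l`-th powers in each unit group -/

section Powers

variable {l : ℕ} [Fact l.Prime] {K : Type*} [Field K] [Algebra ℚ_[l] K] [Algebra ℤ_[l] K]
  [IsScalarTower ℤ_[l] ℚ_[l] K] [FiniteDimensional ℚ_[l] K] {ϖ : K} (hϖ : IsUniformizer l K ϖ)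
  {ζ : K} (hζ : IsPrimitiveRoot ζ l) {m : ℕ} (hm : absVal l K (ζ - 1) = absVal l K ϖ ^ m)
  (hm1 : 1 ≤ m)

-- Compares exponents in |l| = |ζ - 1| ^ (l - 1). It shows that l - 1 divides e and identifies m
-- with e₁.
include hϖ hζ hm in
theorem absVal_prime_eq_pow (hl : absVal l K (l : K) = absVal l K ϖ ^ absRamIdx l K) :
    (l - 1) * m = absRamIdx l K := by
  rw [absVal_prime_eq (isNonarchimedean_absVal l K) hζ, hm, ← pow_mul] at hl
  rw [mul_comm]
  exact pow_right_injective₀ hϖ.1 hϖ.2.1.ne hl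

include hϖ hm hm1 in
theorem absVal_zeta_sub_one_lt : absVal l K (ζ - 1) < 1 := by
  rw [hm]
  exact pow_lt_one₀ hϖ.1.le hϖ.2.1 (Nat.one_le_iff_ne_zero.1 hm1)

include hϖ hζ hm hm1 in
/-- Close to `1`, the `l`-power map sends a unit filtration step onto another. -/
theorem map_pow_unitFiltration :
    (unitFiltration l K ϖ (m + 1)).map (powMonoidHom l) = unitFiltration l K ϖ (l * m + 1) := by
  have hlp : l.Prime := Fact.out
  have hlm : (absVal l K (ζ - 1)) ^ (l - 1) * absVal l K ϖ ^ (m + 1) =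
      absVal l K ϖ ^ (l * m + 1) := by
    rw [hm, ← pow_mul, ← pow_add]
    congr 1
    obtain ⟨k, rfl⟩ := Nat.exists_eq_add_of_lt hlp.pos
    simp only [zero_add, Nat.add_sub_cancel]
    ring
  have hlt : ∀ n, absVal l K ϖ ^ (n + 1) < absVal l K ϖ ^ n := fun n =>
    pow_lt_pow_right_of_lt_one₀ hϖ.1 hϖ.2.1 (Nat.lt_succ_self n)
  have hc := absVal_zeta_sub_one_lt hϖ hm hm1
  have hl := absVal_prime_eq (isNonarchimedean_absVal l K) hζ
  ext u
  rw [Subgroup.mem_map]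
  constructor
  · rintro ⟨y, hy, rfl⟩
    rw [mem_unitFiltration_of_pos hϖ.2.1 (by omega)] at hy ⊢
    have h1 := absVal_one_add_pow_sub_one_le (isNonarchimedean_absVal l K) hc hl
      (z := (y : K) - 1) (by rw [hm]; exact hy.trans (hlt m).le)
    rw [add_sub_cancel] at h1
    rw [← hlm, powMonoidHom_apply, Units.val_pow_eq_pow_val]
    exact h1.trans (mul_le_mul_of_nonneg_left hy (by rw [hm]; positivity))
  · intro hu
    rw [mem_unitFiltration_of_pos hϖ.2.1 (by omega)] at hu
    -- The bound |u - 1| < |ζ - 1| ^ l amounts to u ∈ U_(lm+1), and the root produced satisfies |y -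
    -- 1| < |ϖ| ^ m, which by discreteness puts it in U_(m+1).
    obtain ⟨y, hy, hy1⟩ := exists_pow_eq_of_absVal_sub_one_lt hζ (a := (u : K)) (by
      rw [hm, ← pow_mul, mul_comm m]
      exact hu.trans_lt (hlt _))
    have hy0 : y ≠ 0 := by
      rintro rfl
      rw [zero_pow hlp.ne_zero] at hy
      exact u.ne_zero hy.symm
    refine ⟨Units.mk0 y hy0, ?_, Units.ext hy⟩
    rw [mem_unitFiltration_of_pos hϖ.2.1 (by omega), Units.val_mk0]
    by_cases h0 : y - 1 = 0
    · rw [h0, map_zero]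
      exact (pow_pos hϖ.1 _).le
    obtain ⟨k, hk⟩ := hϖ.2.2 _ h0
    rw [hm, hk, ← zpow_natCast, zpow_lt_zpow_iff_right_of_lt_one₀ hϖ.1 hϖ.2.1] at hy1
    rw [hk, zpow_le_pow_iff hϖ.1 hϖ.2.1]
    push_cast
    omega

include hϖ hζ hm hm1 in
/-- The `l`-th powers in a step of the unit filtration are the `l`-th powers of the elements of
another step. -/
theorem powers_inf_unitFiltration {n k : ℕ} (hk : 1 ≤ k) (hkm : k ≤ m) (hnk : n ≤ l * k)
    (hkn : l * (k - 1) < n) :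
    powers l K ⊓ unitFiltration l K ϖ n = (unitFiltration l K ϖ k).map (powMonoidHom l) := by
  have hlp : l.Prime := Fact.out
  have hc := absVal_zeta_sub_one_lt hϖ hm hm1
  have hl := absVal_prime_eq (isNonarchimedean_absVal l K) hζ
  have hn : 1 ≤ n := by omega
  have hlt : ∀ y : Kˣ, absVal l K (ζ - 1) < absVal l K ((y : K) - 1) →
      absVal l K ((y : K) ^ l - 1) = absVal l K ((y : K) - 1) ^ l := fun y hy => by
    have := absVal_one_add_pow_sub_one_of_lt (isNonarchimedean_absVal l K) hc hl
      ((absVal l K).nonneg _) hy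
    rwa [add_sub_cancel] at this
  ext u
  rw [Subgroup.mem_inf, Subgroup.mem_map]
  constructor
  · rintro ⟨⟨y, rfl⟩, hy⟩
    refine ⟨y, ?_, rfl⟩
    rw [mem_unitFiltration_of_pos hϖ.2.1 hk]
    rw [mem_unitFiltration_of_pos hϖ.2.1 hn, powMonoidHom_apply, Units.val_pow_eq_pow_val] at hy
    -- Otherwise |y - 1| > |ϖ| ^ k ≥ |ζ - 1|, so |y ^ l - 1| = |y - 1| ^ l ≥ |ϖ| ^ (l (k - 1)) > |ϖ|
    -- ^ n. The hypotheses say that k = ⌈n / l⌉.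
    by_contra! h
    rw [hlt y (by
      rw [hm]
      exact (pow_le_pow_of_le_one hϖ.1.le hϖ.2.1.le hkm).trans_lt h)] at hy
    have h0 : (y : K) - 1 ≠ 0 := (absVal l K).pos_iff.1 ((pow_pos hϖ.1 k).trans h)
    obtain ⟨j, hj⟩ := hϖ.2.2 _ h0
    rw [hj, ← zpow_natCast, zpow_lt_zpow_iff_right_of_lt_one₀ hϖ.1 hϖ.2.1] at h
    rw [hj, ← zpow_natCast, ← zpow_mul, zpow_le_pow_iff hϖ.1 hϖ.2.1] at hy
    have h1 : j ≤ ((k - 1 : ℕ) : ℤ) := by omega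
    have h2 : j * l ≤ ((k - 1 : ℕ) : ℤ) * l := mul_le_mul_of_nonneg_right h1 (by positivity)
    have h3 : ((k - 1 : ℕ) : ℤ) * l < n := by
      rw [mul_comm]
      exact_mod_cast hkn
    omega
  · rintro ⟨y, hy, rfl⟩
    refine ⟨⟨y, rfl⟩, ?_⟩
    rw [mem_unitFiltration_of_pos hϖ.2.1 hk] at hy
    rw [mem_unitFiltration_of_pos hϖ.2.1 hn, powMonoidHom_apply, Units.val_pow_eq_pow_val]
    have hle : ∀ j, n ≤ j → absVal l K ϖ ^ j ≤ absVal l K ϖ ^ n := fun j hj =>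
      pow_le_pow_of_le_one hϖ.1.le hϖ.2.1.le hj
    rcases lt_or_ge (absVal l K (ζ - 1)) (absVal l K ((y : K) - 1)) with h | h
    · rw [hlt y h]
      refine (pow_le_pow_left₀ ((absVal l K).nonneg _) hy l).trans ?_
      rw [← pow_mul]
      exact hle _ (by rwa [mul_comm])
    · have h1 := absVal_one_add_pow_sub_one_le (isNonarchimedean_absVal l K) hc hl h
      rw [add_sub_cancel] at h1
      refine h1.trans ((mul_le_mul_of_nonneg_left h (by rw [hm]; positivity)).trans ?_)
      rw [← pow_succ, Nat.sub_add_cancel hlp.one_lt.le, hm, ← pow_mul]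
      exact hle _ (hnk.trans (by rw [mul_comm]; exact Nat.mul_le_mul_right l hkm))

-- Put q = l ^ f. In the chain U_(lm+1) = (U_(m+1)) ^ l ≤ (U_k) ^ l = U_n ∩ (Kˣ) ^ l ≤ U_n the total
-- index is q ^ (lm + 1 - n). The lower step has index [U_k : U_(m+1) μ_l] = q ^ (m + 1 - k) / l,
-- since the roots of unity μ_l lie in U_k and meet U_(m+1) trivially.
include hϖ hζ hm hm1 in
theorem relIndex_powers_unitFiltration {n k : ℕ} (hk : 1 ≤ k) (hkm : k ≤ m) (hnk : n ≤ l * k)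
    (hkn : l * (k - 1) < n) :
    (powers l K).relIndex (unitFiltration l K ϖ n) =
      l * (l ^ absResDeg l K) ^ ((l - 1) * m + k - n) := by
  have hlp : l.Prime := Fact.out
  have hn : 1 ≤ n := by omega
  have hlm : l * m = (l - 1) * m + m := by
    nth_rewrite 1 [← Nat.sub_add_cancel hlp.one_lt.le]
    ring
  have hlk : l * k ≤ l * m := Nat.mul_le_mul_left l hkm
  have hanti := unitFiltration_antitone hϖ.2.1.le
  set p : Kˣ →* Kˣ := powMonoidHom l with hp
  set q := l ^ absResDeg l K with hq
  have hq0 : 0 < q := pow_pos hlp.pos _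
  -- the kernel of the power map meets the filtration as expected
  have hker : p.ker ≤ unitFiltration l K ϖ k := by
    intro x hx
    rw [mem_unitFiltration_of_pos hϖ.2.1 hk]
    have hx' : (x : K) ^ l = 1 := by
      have := congrArg Units.val (MonoidHom.mem_ker.1 hx)
      simpa [hp] using this
    refine (absVal_root_sub_one_le_of_primitive (isNonarchimedean_absVal l K) hζ hx').trans ?_
    rw [hm]
    exact pow_le_pow_of_le_one hϖ.1.le hϖ.2.1.le hkm
  have hker' : unitFiltration l K ϖ (m + 1) ⊓ p.ker = ⊥ := by
    rw [eq_bot_iff]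
    rintro x ⟨hx1, hx⟩
    rw [Subgroup.mem_bot]
    by_contra hne
    have hx' : (x : K) ^ l = 1 := by
      have := congrArg Units.val (MonoidHom.mem_ker.1 hx)
      simpa [hp] using this
    have h1 := hx1.2
    rw [absVal_root_sub_one (isNonarchimedean_absVal l K) hζ hx' (fun h => hne (Units.ext h)),
      hm] at h1
    exact absurd (pow_lt_pow_right_of_lt_one₀ hϖ.1 hϖ.2.1 (Nat.lt_succ_self m)) (not_lt.2 h1)
  have h1 : l * (unitFiltration l K ϖ (m + 1) ⊔ p.ker).relIndex (unitFiltration l K ϖ k) =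
      q ^ (m + 1 - k) := by
    rw [← relIndex_unitFiltration hϖ hk (by omega : k ≤ m + 1),
      ← Subgroup.relIndex_mul_relIndex _ _ _ (le_sup_left : _ ≤ unitFiltration l K ϖ (m + 1) ⊔ p.ker)
        (sup_le (hanti (by omega)) hker), Subgroup.relIndex_sup_left,
      ← Subgroup.inf_relIndex_right _ p.ker, hker', Subgroup.relIndex_bot_left, card_ker_powMonoidHom hζ]
  have h2 : (unitFiltration l K ϖ (m + 1) ⊔ p.ker).relIndex (unitFiltration l K ϖ k) =
      (unitFiltration l K ϖ (l * m + 1)).relIndex ((unitFiltration l K ϖ k).map p) := by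
    rw [← map_pow_unitFiltration hϖ hζ hm hm1, Subgroup.relIndex_map_map, sup_eq_left.2 hker]
  have h3 : (unitFiltration l K ϖ (l * m + 1)).relIndex ((unitFiltration l K ϖ k).map p) *
      (powers l K).relIndex (unitFiltration l K ϖ n) = q ^ (l * m + 1 - n) := by
    rw [← relIndex_unitFiltration hϖ hn (by omega : n ≤ l * m + 1),
      ← Subgroup.inf_relIndex_right (powers l K),
      powers_inf_unitFiltration hϖ hζ hm hm1 hk hkm hnk hkn]
    refine Subgroup.relIndex_mul_relIndex _ _ _ ?_ ?_
    · rw [← map_pow_unitFiltration hϖ hζ hm hm1]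
      exact Subgroup.map_mono (hanti (by omega))
    · rw [← powers_inf_unitFiltration hϖ hζ hm hm1 hk hkm hnk hkn]
      exact inf_le_right
  rw [← h2] at h3
  set X := (unitFiltration l K ϖ (m + 1) ⊔ p.ker).relIndex (unitFiltration l K ϖ k)
  have hX : 0 < X := by
    rcases Nat.eq_zero_or_pos X with h | h
    · rw [h, mul_zero] at h1
      exact absurd h1.symm (pow_pos hq0 _).ne'
    · exact h
  -- No subtraction is truncated here, because n ≤ l k ≤ (l - 1) m + k.
  have h4 : l * m + 1 - n = (m + 1 - k) + ((l - 1) * m + k - n) := by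
    have : n ≤ (l - 1) * m + k := by
      obtain ⟨j, rfl⟩ := Nat.exists_eq_add_of_le hkm
      obtain ⟨i, rfl⟩ := Nat.exists_eq_add_of_lt hlp.pos
      simp only [zero_add, Nat.add_sub_cancel] at *
      nlinarith
    omega
  apply Nat.eq_of_mul_eq_mul_left hX
  rw [h3, h4, pow_add, ← h1]
  ring

end Powers

end LocalKummer

namespace LocalKummer

/-! ### The ring of integers of an extension of `K`, and its trace -/

section IntegersExt

variable {l : ℕ} [Fact l.Prime] {K : Type*} [Field K] [Algebra ℚ_[l] K] [Algebra ℤ_[l] K]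
  [IsScalarTower ℤ_[l] ℚ_[l] K] {L : Type*} [Field L] [Algebra K L] [Algebra ℚ_[l] L]
  [IsScalarTower ℚ_[l] K L]

section Algebraic

variable [Algebra.IsAlgebraic ℚ_[l] K] [Algebra.IsAlgebraic ℚ_[l] L]

theorem mem_integersExt_iff {x : L} : x ∈ integersExt l K L ↔ absVal l L x ≤ 1 := by
  let _ : Algebra ℤ_[l] L := ((algebraMap K L).comp (algebraMap ℤ_[l] K)).toAlgebra
  have : IsScalarTower ℤ_[l] K L := IsScalarTower.of_algebraMap_eq fun _ => rfl
  have : IsScalarTower ℤ_[l] ℚ_[l] L := IsScalarTower.of_algebraMap_eq fun x => by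
    rw [IsScalarTower.algebraMap_apply ℚ_[l] K L, ← IsScalarTower.algebraMap_apply ℤ_[l] ℚ_[l] K]
    rfl
  have : IsScalarTower ℤ_[l] (integers l K) L := IsScalarTower.of_algebraMap_eq fun _ => rfl
  rw [absVal_apply, ← isIntegral_iff_spectralNorm_le_one]
  change IsIntegral (integers l K) x ↔ _
  exact ⟨fun h => isIntegral_trans x h, fun h => h.tower_top⟩

variable [Algebra.IsAlgebraic K L]

theorem mem_maximalIdeal_integersExt_iff (x : integersExt l K L) :
    x ∈ IsLocalRing.maximalIdeal (integersExt l K L) ↔ absVal l L x < 1 := by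
  have hx := mem_integersExt_iff.1 x.2
  rw [IsLocalRing.mem_maximalIdeal, mem_nonunits_iff]
  constructor
  · intro h
    refine lt_of_le_of_ne hx fun h1 => h ?_
    have h0 : (x : L) ≠ 0 := (absVal l L).pos_iff.1 (by rw [h1]; exact one_pos)
    have hinv : (x : L)⁻¹ ∈ integersExt l K L := by
      rw [mem_integersExt_iff, map_inv₀, h1, inv_one]
    exact IsUnit.of_mul_eq_one (⟨_, hinv⟩ : integersExt l K L) (Subtype.ext (mul_inv_cancel₀ h0))
  · rintro h hu
    obtain ⟨y, hy⟩ := hu.exists_right_inv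
    have h2 := mem_integersExt_iff.1 y.2
    have h3 : absVal l L x * absVal l L y = 1 := by
      rw [← map_mul, ← MulMemClass.coe_mul, hy, OneMemClass.coe_one, map_one]
    nlinarith [(absVal l L).nonneg x]

/-- The powers of the maximal ideal in terms of an element generating it. -/
theorem mem_maximalIdeal_integersExt_pow_iff {p : L} (hp0 : p ≠ 0) (hp1 : absVal l L p < 1)
    (hp : ∀ x : L, absVal l L x < 1 → absVal l L x ≤ absVal l L p) (n : ℕ)
    (x : integersExt l K L) :
    x ∈ IsLocalRing.maximalIdeal (integersExt l K L) ^ n ↔ absVal l L x ≤ absVal l L p ^ n := by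
  have hpos := (absVal l L).pos hp0
  let P : integersExt l K L := ⟨p, mem_integersExt_iff.2 hp1.le⟩
  have hdvd : ∀ (n : ℕ) (y : integersExt l K L), P ^ n ∣ y ↔
      absVal l L y ≤ absVal l L p ^ n := by
    intro n y
    constructor
    · rintro ⟨z, rfl⟩
      have hz := mem_integersExt_iff.1 z.2
      have : ((P ^ n * z : integersExt l K L) : L) = p ^ n * z := rfl
      rw [this, map_mul, map_pow]
      exact mul_le_of_le_one_right (pow_nonneg hpos.le _) hz
    · intro hy
      have hmem : (y : L) / p ^ n ∈ integersExt l K L := by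
        rw [mem_integersExt_iff, map_div₀, map_pow]
        exact div_le_one_of_le₀ hy (pow_nonneg hpos.le _)
      refine ⟨⟨_, hmem⟩, Subtype.ext ?_⟩
      change (y : L) = p ^ n * (y / p ^ n)
      field_simp
  have hmax : IsLocalRing.maximalIdeal (integersExt l K L) = Ideal.span {P} := by
    ext y
    rw [mem_maximalIdeal_integersExt_iff, Ideal.mem_span_singleton, ← pow_one P, hdvd, pow_one]
    exact ⟨hp _, fun h => h.trans_lt hp1⟩
  rw [hmax, Ideal.span_singleton_pow, Ideal.mem_span_singleton, hdvd]

end Algebraic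

section Discriminant

variable [FiniteDimensional ℚ_[l] K] [FiniteDimensional K L] [Algebra.IsAlgebraic ℚ_[l] L]
  [IsGalois K L]

/-- The trace over 𝔬 is meaningful because 𝔬_L is finite and free: `L` is separable over `K` and 𝔬
is a principal ideal domain. It is then the restriction of the trace of `L` over `K`, so
discriminants can be computed in the fields. -/
theorem algebraMap_trace_integersExt (x : integersExt l K L) :
    algebraMap (integers l K) K (Algebra.trace (integers l K) (integersExt l K L) x) =
      Algebra.trace K L (x : L) := by
  have : IsFractionRing (integers l K) K :=
    integralClosure.isFractionRing_of_finite_extension ℚ_[l] K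
  have : IsScalarTower (integers l K) K L := IsScalarTower.of_algebraMap_eq fun _ => rfl
  have : Module.IsTorsionFree (integers l K) L := by
    refine Module.isTorsionFree_iff_algebraMap_injective.2 ?_
    rw [IsScalarTower.algebraMap_eq (integers l K) K L]
    exact (algebraMap K L).injective.comp (IsFractionRing.injective _ _)
  have : Module.IsTorsionFree (integers l K) (integersExt l K L) := by
    refine Module.isTorsionFree_iff_algebraMap_injective.2 fun x y hxy => ?_
    exact Module.isTorsionFree_iff_algebraMap_injective.1 ‹Module.IsTorsionFree (integers l K) L›
      (congrArg Subtype.val hxy)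
  have : Module.Finite (integers l K) (integersExt l K L) :=
    IsIntegralClosure.finite (integers l K) K L (integersExt l K L)
  have : Module.Free (integers l K) (integersExt l K L) :=
    IsIntegralClosure.module_free (integers l K) K L (integersExt l K L)
  have : IsDedekindDomain (integersExt l K L) :=
    integralClosure.isDedekindDomain (integers l K) K L
  have : IsScalarTower (integers l K) (integersExt l K L) L :=
    IsScalarTower.of_algebraMap_eq fun _ => rfl
  rw [← Algebra.intTrace_eq_trace]
  exact Algebra.algebraMap_intTrace (A := integers l K) (K := K) (L := L)
    (B := integersExt l K L) x

theorem algebraMap_discr_integersExt {ι : Type*} [Fintype ι] [DecidableEq ι]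
    (b : ι → integersExt l K L) :
    algebraMap (integers l K) K (Algebra.discr (integers l K) b) =
      Algebra.discr K (fun i => (b i : L)) := by
  rw [Algebra.discr_def, Algebra.discr_def, RingHom.map_det]
  congr 1
  ext i j
  simp only [RingHom.mapMatrix_apply, Matrix.map_apply, Algebra.traceMatrix_apply,
    Algebra.traceForm_apply]
  exact algebraMap_trace_integersExt (b i * b j)

end Discriminant

end IntegersExt

/-! ### Discriminants through the conjugates -/

section Vandermonde

variable {K L : Type*} [Field K] [Field L] [Algebra K L] [FiniteDimensional K L] [IsGalois K L]

/-- The trace is the sum over the Galois group, so the trace matrix is M Mᵀ with M the matrix of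
conjugates. -/
theorem algebraMap_discr_eq_det_sq {ι : Type*} [Fintype ι] [DecidableEq ι] (e : ι ≃ Gal(L/K))
    (b : ι → L) :
    algebraMap K L (Algebra.discr K b) = (Matrix.of fun i j => e j (b i)).det ^ 2 := by
  rw [Algebra.discr_def, RingHom.map_det, pow_two]
  nth_rewrite 3 [← Matrix.det_transpose]
  rw [← Matrix.det_mul]
  congr 1
  ext i j
  simp only [RingHom.mapMatrix_apply, Matrix.map_apply, Algebra.traceMatrix_apply,
    Algebra.traceForm_apply, Matrix.mul_apply, Matrix.of_apply, Matrix.transpose_apply]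
  rw [trace_eq_sum_automorphisms, ← Equiv.sum_comp e]
  simp

theorem algebraMap_discr_pow {n : ℕ} (e : Fin n ≃ Gal(L/K)) (x : L) :
    algebraMap K L (Algebra.discr K fun i : Fin n => x ^ (i : ℕ)) =
      (∏ i, ∏ j ∈ Finset.Ioi i, (e j x - e i x)) ^ 2 := by
  rw [algebraMap_discr_eq_det_sq e, ← Matrix.det_vandermonde, ← Matrix.det_transpose]
  congr 2
  ext i j
  simp [Matrix.vandermonde_apply]

theorem sq_prod_prod_Ioi_const {R : Type*} [CommMonoid R] (n : ℕ) (C : R) :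
    (∏ i : Fin n, ∏ _j ∈ Finset.Ioi i, C) ^ 2 = C ^ (n * (n - 1)) := by
  simp only [Finset.prod_const, Fin.card_Ioi, Finset.prod_pow_eq_pow_sum, ← pow_mul]
  congr 1
  rw [Fin.sum_univ_eq_sum_range (fun i => n - 1 - i) n, Finset.sum_range_reflect (fun i => i) n,
    Finset.sum_range_id_mul_two]

/-- The absolute value of the discriminant of the powers of an element all of whose conjugates
are at the same distance. -/
theorem absVal_discr_pow (l : ℕ) [Fact l.Prime] [Algebra ℚ_[l] L] [Algebra.IsAlgebraic ℚ_[l] L]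
    [Algebra ℚ_[l] K] [IsScalarTower ℚ_[l] K L] [Algebra.IsAlgebraic ℚ_[l] K] {x : L} {C : ℝ}
    (hC : ∀ σ : Gal(L/K), σ ≠ 1 → absVal l L (σ x - x) = C) :
    absVal l K (Algebra.discr K fun i : Fin (Module.finrank K L) => x ^ (i : ℕ)) =
      C ^ (Module.finrank K L * (Module.finrank K L - 1)) := by
  have e : Fin (Module.finrank K L) ≃ Gal(L/K) :=
    (Finite.equivFinOfCardEq (IsGalois.card_aut_eq_finrank K L)).symm
  rw [← absVal_algebraMap l K L, algebraMap_discr_pow e, map_pow, map_prod,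
    ← sq_prod_prod_Ioi_const]
  congr 1
  refine Finset.prod_congr rfl fun i _ => ?_
  rw [map_prod]
  refine Finset.prod_congr rfl fun j hj => ?_
  -- Galois invariance of the absolute value moves the distance between two conjugates of x to one
  -- between x itself and a conjugate.
  have hne : (e i)⁻¹ * e j ≠ 1 := by
    intro h
    exact (Finset.mem_Ioi.1 hj).ne (e.injective (inv_mul_eq_one.1 h))
  rw [← hC _ hne, ← absVal_algEquiv (e i) (((e i)⁻¹ * e j) x - x), map_sub (e i), ← AlgEquiv.mul_apply,
    mul_inv_cancel_left]

end Vandermonde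

end LocalKummer

namespace LocalKummer

/-! ### Degree-`l` extensions with an element p such that |p| ^ l = |ϖ| -/

section TotallyRamified

variable {l : ℕ} [Fact l.Prime] {K : Type*} [Field K] [Algebra ℚ_[l] K]
  [FiniteDimensional ℚ_[l] K] {L : Type*} [Field L] [Algebra K L] [Algebra ℚ_[l] L]
  [IsScalarTower ℚ_[l] K L] [Algebra.IsAlgebraic ℚ_[l] L]
  {ϖ : K} (hϖ : IsUniformizer l K ϖ) {p : L} (hp : absVal l L p ^ l = absVal l K ϖ)

include hp in
theorem absVal_smul_pow_pow (c : K) (k : ℕ) :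
    absVal l L (algebraMap K L c * p ^ k) ^ l = absVal l K c ^ l * absVal l K ϖ ^ k := by
  rw [map_mul, absVal_algebraMap, map_pow, mul_pow, ← pow_mul, mul_comm k, pow_mul, hp]

include hϖ hp in
theorem absVal_uniformizer_pos : 0 < absVal l L p := by
  have hlp : l.Prime := Fact.out
  refine (absVal l L).pos fun h => ?_
  rw [h, map_zero, zero_pow hlp.ne_zero] at hp
  exact hϖ.1.ne hp

include hϖ hp in
theorem absVal_uniformizer_lt_one : absVal l L p < 1 := by
  by_contra! h
  have := one_le_pow₀ h (n := l)
  rw [hp] at this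
  exact absurd hϖ.2.1 (not_lt.2 this)

include hϖ hp in
/-- The powers `p ^ k` (`k < l`) have distinct absolute values modulo that of `K`. -/
theorem absVal_smul_pow_ne {c d : K} (hc : c ≠ 0) (hd : d ≠ 0) {j k : ℕ} (hj : j < l) (hk : k < l)
    (hjk : j ≠ k) :
    absVal l L (algebraMap K L c * p ^ j) ≠ absVal l L (algebraMap K L d * p ^ k) := by
  intro h
  have h' := congrArg (· ^ l) h
  simp only [absVal_smul_pow_pow hp] at h'
  obtain ⟨a, ha⟩ := hϖ.2.2 c hc
  obtain ⟨b, hb⟩ := hϖ.2.2 d hd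
  rw [ha, hb, ← zpow_natCast, ← zpow_natCast, ← zpow_natCast, ← zpow_natCast, ← zpow_mul,
    ← zpow_mul, ← zpow_add₀ hϖ.1.ne', ← zpow_add₀ hϖ.1.ne'] at h'
  have h2 := zpow_right_injective₀ hϖ.1 hϖ.2.1.ne h'
  have h3 : ((j : ℤ) - k) = l * (b - a) := by linear_combination h2
  have h4 : b - a = 0 := by
    by_contra hne
    have h5 : (l : ℤ) ≤ |(j : ℤ) - k| := by
      rw [h3, abs_mul, Nat.abs_cast]
      exact le_mul_of_one_le_right (by positivity) (Int.one_le_abs hne)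
    have h6 : |(j : ℤ) - k| < l := by
      rw [abs_lt]
      constructor <;> omega
    omega
  rw [h4, mul_zero] at h3
  omega

-- The nonzero terms have pairwise distinct absolute values, so the largest one gives that of the
-- sum. Both the independence of 1, p, …, p ^ (l - 1) and the integrality of coordinates follow.
include hϖ hp in
theorem absVal_sum_smul_pow {n : ℕ} (hn : n = l) (c : Fin n → K) (hc : c ≠ 0) :
    ∃ k, c k ≠ 0 ∧ absVal l L (∑ i, algebraMap K L (c i) * p ^ (i : ℕ)) =
        absVal l L (algebraMap K L (c k) * p ^ (k : ℕ)) ∧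
      ∀ i, absVal l L (algebraMap K L (c i) * p ^ (i : ℕ)) ≤
        absVal l L (algebraMap K L (c k) * p ^ (k : ℕ)) := by
  obtain ⟨k₁, hk₁⟩ := Function.ne_iff.1 hc
  have hp0 : p ≠ 0 := (absVal l L).pos_iff.1 (absVal_uniformizer_pos hϖ hp)
  obtain ⟨k, -, hk⟩ := Finset.exists_max_image Finset.univ
    (fun i : Fin n => absVal l L (algebraMap K L (c i) * p ^ (i : ℕ))) ⟨k₁, Finset.mem_univ _⟩
  have hpos : 0 < absVal l L (algebraMap K L (c k) * p ^ (k : ℕ)) :=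
    ((absVal l L).pos (mul_ne_zero ((map_ne_zero _).2 hk₁) (pow_ne_zero _ hp0))).trans_le
      (hk k₁ (Finset.mem_univ _))
  have hck : c k ≠ 0 := by
    rintro h
    rw [h] at hpos
    simp at hpos
  refine ⟨k, hck, ?_, fun i => hk i (Finset.mem_univ _)⟩
  refine (isNonarchimedean_absVal l L).apply_sum_eq_of_lt (fun a => (AbsoluteValue.map_neg _ a).symm)
    (Finset.mem_univ k) fun j _ hj => lt_of_le_of_ne (hk j (Finset.mem_univ _)) ?_
  by_cases hcj : c j = 0
  · rw [hcj]
    simpa using hpos.ne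
  · exact absVal_smul_pow_ne hϖ hp hcj hck (hn ▸ j.2) (hn ▸ k.2) (fun h => hj (Fin.ext h))

variable (hfin : Module.finrank K L = l)

include hϖ hp hfin in
theorem exists_eq_sum_smul_pow (x : L) : ∃ c : Fin (Module.finrank K L) → K,
    x = ∑ i, algebraMap K L (c i) * p ^ (i : ℕ) := by
  have hlp : l.Prime := Fact.out
  have hp0 : p ≠ 0 := (absVal l L).pos_iff.1 (absVal_uniformizer_pos hϖ hp)
  have : FiniteDimensional K L := FiniteDimensional.of_finrank_pos (hfin ▸ hlp.pos)
  have hli : LinearIndependent K (fun i : Fin (Module.finrank K L) => p ^ (i : ℕ)) := by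
    rw [Fintype.linearIndependent_iff]
    intro c hc
    by_contra! hne
    obtain ⟨i, hi⟩ := hne
    obtain ⟨k, hk, hk1, -⟩ := absVal_sum_smul_pow hϖ hp hfin c (Function.ne_iff.2 ⟨i, hi⟩)
    simp only [Algebra.smul_def] at hc
    rw [hc, map_zero] at hk1
    exact mul_ne_zero ((map_ne_zero _).2 hk) (pow_ne_zero _ hp0) ((absVal l L).eq_zero.1 hk1.symm)
  have hspan := hli.span_eq_top_of_card_eq_finrank' (by simp)
  have hx : x ∈ Submodule.span K (Set.range fun i : Fin (Module.finrank K L) => p ^ (i : ℕ)) := by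
    rw [hspan]
    trivial
  obtain ⟨c, hc⟩ := (Submodule.mem_span_range_iff_exists_fun K).1 hx
  exact ⟨c, by simp only [← hc, Algebra.smul_def]⟩

include hϖ hp hfin in
theorem absVal_pow_eq_zpow {x : L} (hx : x ≠ 0) : ∃ k : ℤ, absVal l L x ^ l = absVal l K ϖ ^ k := by
  obtain ⟨c, rfl⟩ := exists_eq_sum_smul_pow hϖ hp hfin x
  have hc : c ≠ 0 := by
    rintro rfl
    simp at hx
  obtain ⟨k, hk, hk1, -⟩ := absVal_sum_smul_pow hϖ hp hfin c hc
  obtain ⟨a, ha⟩ := hϖ.2.2 _ hk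
  refine ⟨a * l + (k : ℕ), ?_⟩
  rw [hk1, absVal_smul_pow_pow hp, ha, zpow_add₀ hϖ.1.ne', zpow_mul, zpow_natCast, zpow_natCast]

include hϖ hp hfin in
theorem absVal_le_uniformizer_of_lt_one {x : L} (hx : absVal l L x < 1) :
    absVal l L x ≤ absVal l L p := by
  have hlp : l.Prime := Fact.out
  by_cases h0 : x = 0
  · rw [h0, map_zero]
    exact (absVal l L).nonneg _
  obtain ⟨k, hk⟩ := absVal_pow_eq_zpow hϖ hp hfin h0
  have h1 : absVal l L x ^ l < 1 := pow_lt_one₀ ((absVal l L).nonneg _) hx hlp.ne_zero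
  rw [← pow_le_pow_iff_left₀ ((absVal l L).nonneg _) ((absVal l L).nonneg _) hlp.ne_zero, hp]
  rw [hk] at h1 ⊢
  have := (zpow_lt_zpow_iff_right_of_lt_one₀ hϖ.1 hϖ.2.1 (m := k) (n := 0)).1 (by simpa using h1)
  have h4 := (zpow_le_pow_iff hϖ.1 hϖ.2.1 k 1).2 (by push_cast; omega)
  simpa using h4

-- This is 𝔬_L = 𝔬[p]. Each term of an integral sum is integral, and as i < l, |c p ^ i| ≤ 1 gives
-- v_K(c) ≥ -i / l > -1, hence v_K(c) ≥ 0.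
include hϖ hp hfin in
theorem exists_integral_eq_sum_smul_pow {x : L} (hx : absVal l L x ≤ 1) :
    ∃ c : Fin (Module.finrank K L) → K, (∀ i, absVal l K (c i) ≤ 1) ∧
      x = ∑ i, algebraMap K L (c i) * p ^ (i : ℕ) := by
  obtain ⟨c, hc⟩ := exists_eq_sum_smul_pow hϖ hp hfin x
  refine ⟨c, fun i => ?_, hc⟩
  by_cases hci : c i = 0
  · rw [hci, map_zero]
    exact zero_le_one
  obtain ⟨k, -, hk1, hk2⟩ := absVal_sum_smul_pow hϖ hp hfin c (Function.ne_iff.2 ⟨i, hci⟩)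
  have h1 : absVal l L (algebraMap K L (c i) * p ^ (i : ℕ)) ≤ 1 := by
    refine (hk2 i).trans ?_
    rw [← hk1, ← hc]
    exact hx
  have h2 := pow_le_one₀ ((absVal l L).nonneg _) h1 (n := l)
  obtain ⟨a, ha⟩ := hϖ.2.2 _ hci
  rw [absVal_smul_pow_pow hp, ha, ← zpow_natCast, ← zpow_natCast, ← zpow_mul,
    ← zpow_add₀ hϖ.1.ne', ← pow_zero (absVal l K ϖ), zpow_le_pow_iff hϖ.1 hϖ.2.1] at h2
  rw [ha, ← pow_zero (absVal l K ϖ), zpow_le_pow_iff hϖ.1 hϖ.2.1]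
  by_contra! hneg
  have h3 : (i : ℕ) < l := hfin ▸ i.2
  push_cast at h2 hneg
  have h4 : a * l ≤ -1 * l := mul_le_mul_of_nonneg_right (by omega) (by positivity)
  omega

end TotallyRamified

/-! ### Ramification break and discriminant from one well-chosen element -/

section Break

variable {l : ℕ} [Fact l.Prime] {K : Type*} [Field K] [Algebra ℚ_[l] K] [Algebra ℤ_[l] K]
  [IsScalarTower ℤ_[l] ℚ_[l] K] [FiniteDimensional ℚ_[l] K] {L : Type*} [Field L] [Algebra K L]
  [Algebra ℚ_[l] L] [IsScalarTower ℚ_[l] K L] [Algebra.IsAlgebraic ℚ_[l] L]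
  [FiniteDimensional K L] [IsGalois K L]

section Uniformizer

variable {ϖ : K} (hϖ : IsUniformizer l K ϖ) (hfin : Module.finrank K L = l) {p : L}
  (hp : absVal l L p ^ l = absVal l K ϖ) {t : ℕ}
  (ht : ∀ σ : Gal(L/K), σ ≠ 1 → absVal l L (σ p - p) = absVal l L p ^ (t + 1))

-- As p generates 𝔬_L over 𝔬, no integral element is moved further than p: σ p - p divides every σ x
-- - x.
include hϖ hfin hp ht in
theorem hasRamificationBreak_of_uniformizer : HasRamificationBreak l K L t := by
  have hpos := absVal_uniformizer_pos hϖ hp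
  have hlt := absVal_uniformizer_lt_one hϖ hp
  have hmem := mem_maximalIdeal_integersExt_pow_iff (K := K) ((absVal l L).pos_iff.1 hpos) hlt
    fun x hx => absVal_le_uniformizer_of_lt_one hϖ hp hfin hx
  have hσp : ∀ σ : Gal(L/K), absVal l L (σ p - p) ≤ absVal l L p ^ (t + 1) := by
    intro σ
    by_cases h : σ = 1
    · subst h
      simp [(pow_pos hpos _).le]
    · exact (ht σ h).le
  constructor
  · rw [eq_top_iff]
    rintro σ - x
    have hx := mem_integersExt_iff.1 x.2
    have hxσ : absVal l L (σ x - x) ≤ absVal l L p ^ (t + 1) := by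
      obtain ⟨c, hc, hxc⟩ := exists_integral_eq_sum_smul_pow hϖ hp hfin hx
      rw [hxc, map_sum, ← Finset.sum_sub_distrib]
      refine sum_le_of_forall_le (isNonarchimedean_absVal l L) _ _ (pow_pos hpos _).le fun i _ => ?_
      rw [map_mul σ, AlgEquiv.commutes, map_pow, ← mul_sub, map_mul, absVal_algebraMap]
      have h1 : absVal l L (σ p ^ (i : ℕ) - p ^ (i : ℕ)) ≤ absVal l L p ^ (t + 1) := by
        rw [← (Commute.all (σ p) p).geom_sum₂_mul, map_mul]
        refine (mul_le_of_le_one_left ((absVal l L).nonneg _) ?_).trans (hσp σ)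
        refine sum_le_of_forall_le (isNonarchimedean_absVal l L) _ _ zero_le_one fun j _ => ?_
        rw [map_mul, map_pow, map_pow, absVal_algEquiv]
        exact mul_le_one₀ (pow_le_one₀ hpos.le hlt.le) (pow_nonneg hpos.le _)
          (pow_le_one₀ hpos.le hlt.le)
      exact (mul_le_of_le_one_left ((absVal l L).nonneg _) (hc i)).trans h1
    have hint : σ x - x ∈ integersExt l K L :=
      mem_integersExt_iff.2 (hxσ.trans (pow_le_one₀ hpos.le hlt.le))
    exact ⟨⟨_, hint⟩, (hmem _ _).2 hxσ, rfl⟩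
  · rw [eq_bot_iff]
    intro σ hσ
    rw [Subgroup.mem_bot]
    by_contra hne
    obtain ⟨y, hy, hy'⟩ := hσ ⟨p, mem_integersExt_iff.2 hlt.le⟩
    have h1 := (hmem _ _).1 hy
    rw [hy', ht σ hne] at h1
    -- G_(t+1) requires σ p - p ∈ 𝔩 ^ (t + 2), but its valuation is exactly t + 1.
    have h2 : ((t : ℤ) + 1 + 1).toNat = t + 1 + 1 := by omega
    rw [h2] at h1
    exact absurd (pow_lt_pow_right_of_lt_one₀ hpos hlt (Nat.lt_succ_self (t + 1))) (not_lt.2 h1)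

include hϖ in
theorem mem_maximalIdeal_integers_pow_iff (n : ℕ) (x : integers l K) :
    x ∈ IsLocalRing.maximalIdeal (integers l K) ^ n ↔ absVal l K x ≤ absVal l K ϖ ^ n := by
  let P : integers l K := ⟨ϖ, (mem_integers_iff l K).2 hϖ.2.1.le⟩
  have hdvd : ∀ (n : ℕ) (y : integers l K), P ^ n ∣ y ↔
      absVal l K y ≤ absVal l K ϖ ^ n := by
    intro n y
    constructor
    · rintro ⟨z, rfl⟩
      have hz := (mem_integers_iff l K).1 z.2
      have : ((P ^ n * z : integers l K) : K) = ϖ ^ n * z := rfl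
      rw [this, map_mul, map_pow]
      exact mul_le_of_le_one_right (pow_nonneg hϖ.1.le _) hz
    · intro hy
      have hmem : (y : K) / ϖ ^ n ∈ integers l K := by
        rw [mem_integers_iff, map_div₀, map_pow]
        exact div_le_one_of_le₀ hy (pow_nonneg hϖ.1.le _)
      have hϖ0 : ϖ ≠ 0 := (absVal l K).pos_iff.1 hϖ.1
      refine ⟨⟨_, hmem⟩, Subtype.ext ?_⟩
      change (y : K) = ϖ ^ n * (y / ϖ ^ n)
      field_simp
  have hmax : IsLocalRing.maximalIdeal (integers l K) = Ideal.span {P} := by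
    ext y
    rw [mem_maximalIdeal_integers_iff, Ideal.mem_span_singleton, ← pow_one P, hdvd, pow_one]
    refine ⟨fun h => ?_, fun h => h.trans_lt hϖ.2.1⟩
    by_cases h0 : (y : K) = 0
    · rw [h0, map_zero]
      exact hϖ.1.le
    obtain ⟨k, hk⟩ := hϖ.2.2 _ h0
    rw [hk] at h ⊢
    have := (zpow_lt_zpow_iff_right_of_lt_one₀ hϖ.1 hϖ.2.1 (m := k) (n := 0)).1 (by simpa using h)
    have h4 := (zpow_le_pow_iff hϖ.1 hϖ.2.1 k 1).2 (by push_cast; omega)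
    simpa using h4
  rw [hmax, Ideal.span_singleton_pow, Ideal.mem_span_singleton, hdvd]

-- Any family in 𝔬_L is an integral matrix applied to the powers of p, which multiplies the
-- discriminant by an integral square. So disc(1, p, …, p ^ (l - 1)) generates the ideal, and its
-- size is |p| ^ ((t + 1) l (l - 1)) = |ϖ| ^ ((t + 1)(l - 1)).
include hϖ hfin hp ht in
theorem discrVal_of_uniformizer : discrVal l K L = ((l - 1) * (1 + t) : ℕ) := by
  have hpos := absVal_uniformizer_pos hϖ hp
  have hlt := absVal_uniformizer_lt_one hϖ hp
  set n := (l - 1) * (1 + t) with hn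
  have hD : absVal l K (Algebra.discr K fun i : Fin (Module.finrank K L) => p ^ (i : ℕ)) =
      absVal l K ϖ ^ n := by
    rw [absVal_discr_pow l ht, ← hp, ← pow_mul, ← pow_mul, hfin, hn]
    congr 1
    ring
  have hideal : discrIdeal l K L = IsLocalRing.maximalIdeal (integers l K) ^ n := by
    apply le_antisymm
    · rw [discrIdeal, Ideal.span_le]
      rintro _ ⟨b, rfl⟩
      rw [SetLike.mem_coe, mem_maximalIdeal_integers_pow_iff hϖ]
      have h1 : ((Algebra.discr (integers l K) b : integers l K) : K) =
          Algebra.discr K (fun i => (b i : L)) := algebraMap_discr_integersExt b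
      rw [h1, ← hD]
      choose c hc hbc using fun i => exists_integral_eq_sum_smul_pow hϖ hp hfin
        (mem_integersExt_iff.1 (b i).2)
      have h2 : (fun i => (b i : L)) = ((Matrix.of c).map (algebraMap K L)).mulVec
          (fun i => p ^ (i : ℕ)) := by
        ext i
        rw [hbc i]
        rfl
      rw [h2, Algebra.discr_of_matrix_mulVec, map_mul, map_pow]
      refine mul_le_of_le_one_left ((absVal l K).nonneg _) (pow_le_one₀ ((absVal l K).nonneg _) ?_)
      rw [Matrix.det_apply]
      refine sum_le_of_forall_le (isNonarchimedean_absVal l K) _ _ zero_le_one fun σ _ => ?_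
      have h3 : absVal l K (∏ i, Matrix.of c (σ i) i) ≤ 1 := by
        rw [map_prod]
        exact Finset.prod_le_one (fun _ _ => (absVal l K).nonneg _) fun i _ => hc _ _
      rcases Int.units_eq_one_or (Equiv.Perm.sign σ) with h | h <;> rw [h] <;> simpa using h3
    · intro x hx
      rw [mem_maximalIdeal_integers_pow_iff hϖ, ← hD] at hx
      let b : Fin (Module.finrank K L) → integersExt l K L := fun i =>
        ⟨p ^ (i : ℕ), mem_integersExt_iff.2 (by rw [map_pow]; exact pow_le_one₀ hpos.le hlt.le)⟩
      set D := Algebra.discr (integers l K) b with hDb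
      have h1 : (D : K) = Algebra.discr K (fun i : Fin (Module.finrank K L) => p ^ (i : ℕ)) :=
        algebraMap_discr_integersExt b
      rw [← h1] at hx hD
      have hD0 : 0 < absVal l K (D : K) := by
        rw [hD]
        exact pow_pos hϖ.1 _
      have hD0' : (D : K) ≠ 0 := (absVal l K).pos_iff.1 hD0
      have hq : (x : K) / D ∈ integers l K := by
        rw [mem_integers_iff, map_div₀]
        exact div_le_one_of_le₀ hx hD0.le
      have : x = (⟨_, hq⟩ : integers l K) * D := Subtype.ext (by
        change (x : K) = x / D * D
        field_simp)
      rw [this]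
      exact Ideal.mul_mem_left _ _ (Ideal.subset_span ⟨b, rfl⟩)
  rw [discrVal, hideal]
  refine emultiplicity_pow_self (IsDiscreteValuationRing.not_a_field _) ?_ n
  rw [Ideal.isUnit_iff]
  exact (IsLocalRing.maximalIdeal.isMaximal _).ne_top

end Uniformizer

/-- An element of valuation prime to `l`, moved by the Galois group as prescribed, determines the
ramification break and the discriminant. -/
theorem hasRamificationBreak_and_discrVal {ϖ : K} (hϖ : IsUniformizer l K ϖ)
    (hfin : Module.finrank K L = l) {β : L} {m : ℤ} (hm : IsCoprime m (l : ℤ))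
    (hβ : absVal l L β ^ l = absVal l K ϖ ^ m) {t : ℕ} (ht1 : 1 ≤ t)
    (ht : ∀ σ : Gal(L/K), σ ≠ 1 → absVal l L (σ β / β - 1) ^ l = absVal l K ϖ ^ t) :
    HasRamificationBreak l K L t ∧ discrVal l K L = ((l - 1) * (1 + t) : ℕ) := by
  have hlp : l.Prime := Fact.out
  have hlZ : (0 : ℤ) < l := by exact_mod_cast hlp.pos
  -- Bézout makes β ^ i ϖ ^ j a uniformizer of `L`. Taking i ≥ 0 lets (1 + w) ^ i - 1 be factored by
  -- a geometric sum; i is prime to `l`, so |i| = 1.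
  obtain ⟨i, j, hij⟩ : ∃ (i : ℕ) (j : ℤ), i * m + j * l = 1 := by
    obtain ⟨a, b, hab⟩ := hm
    refine ⟨(a % l).toNat, b + a / l * m, ?_⟩
    rw [Int.toNat_of_nonneg (Int.emod_nonneg _ hlZ.ne')]
    linear_combination hab - m * (Int.emod_add_mul_ediv a l).symm
  have hi : ¬ (l : ℤ) ∣ i := by
    rintro ⟨k, hk⟩
    have : (l : ℤ) ∣ 1 := ⟨k * m + j, by rw [← hij, hk]; ring⟩
    have := Int.le_of_dvd one_pos this
    have := hlp.two_le
    omega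
  have hβ0 : β ≠ 0 := by
    rintro rfl
    rw [map_zero, zero_pow hlp.ne_zero] at hβ
    exact (zpow_pos hϖ.1 m).ne hβ
  have hϖ0 : algebraMap K L ϖ ≠ 0 := (map_ne_zero _).2 ((absVal l K).pos_iff.1 hϖ.1)
  set p : L := β ^ i * algebraMap K L ϖ ^ j with hpdef
  have hp0 : p ≠ 0 := mul_ne_zero (pow_ne_zero _ hβ0) (zpow_ne_zero _ hϖ0)
  have hp : absVal l L p ^ l = absVal l K ϖ := by
    rw [hpdef, map_mul, map_pow, map_zpow₀, absVal_algebraMap, mul_pow, ← pow_mul, mul_comm i,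
      pow_mul, hβ, ← zpow_natCast, ← zpow_natCast, ← zpow_mul, ← zpow_mul, ← zpow_add₀ hϖ.1.ne',
      mul_comm m, hij, zpow_one]
  have hNi : absVal l L (i : L) = 1 := by
    rw [← map_natCast (algebraMap ℚ_[l] L), absVal_apply, spectralNorm_extends]
    rw [Padic.norm_natCast_eq_one_iff]
    exact (Nat.Prime.coprime_iff_not_dvd hlp).2 fun h => hi (Int.natCast_dvd_natCast.2 h)
  have hσ : ∀ σ : Gal(L/K), σ ≠ 1 → absVal l L (σ p - p) = absVal l L p ^ (t + 1) := by
    intro σ hne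
    set w := σ β / β - 1 with hw
    have hwl := ht σ hne
    have hw1 : absVal l L w < 1 := by
      by_contra! h
      have h1 := one_le_pow₀ h (n := l)
      rw [hwl] at h1
      exact absurd (pow_lt_one₀ hϖ.1.le hϖ.2.1 (Nat.one_le_iff_ne_zero.1 ht1)) (not_lt.2 h1)
    have hu1 : absVal l L (1 + w) = 1 := by
      apply absVal_eq_one_of_sub_one_lt
      rwa [add_sub_cancel_left]
    have hσp : σ p - p = p * ((1 + w) ^ i - 1) := by
      have h1 : σ β = β * (1 + w) := by
        rw [hw]
        field_simp
        ring
      rw [hpdef, map_mul, map_pow, map_zpow₀, AlgEquiv.commutes, h1]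
      ring
    -- The geometric sum is congruent to the unit i, so |(1 + w) ^ i - 1| = |w|: σ moves the
    -- uniformizer, relatively, exactly as much as it moves β.
    have hdiff : absVal l L (∑ k ∈ Finset.range i, (1 + w) ^ k - i) < 1 := by
      have h2 : (∑ k ∈ Finset.range i, (1 + w) ^ k - i : L) =
          ∑ k ∈ Finset.range i, ((1 + w) ^ k - 1) := by
        rw [Finset.sum_sub_distrib]
        simp
      rw [h2]
      refine (sum_le_of_forall_le (isNonarchimedean_absVal l L) _ _ ((absVal l L).nonneg w)
        fun k _ => ?_).trans_lt hw1
      rw [← geom_sum_mul, add_sub_cancel_left, map_mul]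
      refine mul_le_of_le_one_left ((absVal l L).nonneg _) ?_
      refine sum_le_of_forall_le (isNonarchimedean_absVal l L) _ _ zero_le_one fun r _ => ?_
      rw [map_pow, hu1, one_pow]
    have hS : absVal l L (∑ k ∈ Finset.range i, (1 + w) ^ k) = 1 := by
      rw [← sub_add_cancel (∑ k ∈ Finset.range i, (1 + w) ^ k) (i : L),
        (isNonarchimedean_absVal l L).add_eq_right_of_lt (by rwa [hNi]), hNi]
    have hw' : absVal l L w = absVal l L p ^ t := by
      rw [← pow_left_inj₀ ((absVal l L).nonneg _) (pow_nonneg ((absVal l L).nonneg _) _)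
        hlp.ne_zero, hwl, ← pow_mul, mul_comm t, pow_mul, hp]
    clear_value p w
    rw [hσp, map_mul, ← geom_sum_mul, add_sub_cancel_left, map_mul, hS, one_mul, hw', pow_succ,
      mul_comm]
  exact ⟨hasRamificationBreak_of_uniformizer hϖ hfin hp hσ, discrVal_of_uniformizer hϖ hfin hp hσ⟩

section Unramified

variable {β : L} (hβ : absVal l L β ≤ 1)
  (hσ : ∀ σ : Gal(L/K), σ ≠ 1 → absVal l L (σ β - β) = 1)

include hβ hσ in
theorem ramificationGroup_zero_eq_bot : ramificationGroup l K L 0 = ⊥ := by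
  rw [eq_bot_iff]
  intro σ h
  rw [Subgroup.mem_bot]
  by_contra hne
  obtain ⟨y, hy, hy'⟩ := h ⟨β, mem_integersExt_iff.2 hβ⟩
  have h1 : ((0 : ℤ) + 1).toNat = 1 := rfl
  rw [h1, pow_one, mem_maximalIdeal_integersExt_iff, hy', hσ σ hne] at hy
  exact lt_irrefl _ hy

-- The powers of β already have a unit as discriminant, so the discriminant ideal is everything.
include hβ hσ in
theorem discrVal_eq_zero : discrVal l K L = 0 := by
  have hD := absVal_discr_pow l hσ
  rw [one_pow] at hD
  let b : Fin (Module.finrank K L) → integersExt l K L := fun i =>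
    ⟨β ^ (i : ℕ), mem_integersExt_iff.2
      (by rw [map_pow]; exact pow_le_one₀ ((absVal l L).nonneg _) hβ)⟩
  have h1 : ((Algebra.discr (integers l K) b : integers l K) : K) =
      Algebra.discr K (fun i : Fin (Module.finrank K L) => β ^ (i : ℕ)) :=
    algebraMap_discr_integersExt b
  rw [← h1, ← isUnit_integers_iff] at hD
  have htop : discrIdeal l K L = ⊤ :=
    Ideal.eq_top_of_isUnit_mem _ (Ideal.subset_span ⟨b, rfl⟩) hD
  rw [discrVal, htop, emultiplicity_eq_zero, Ideal.dvd_iff_le, top_le_iff]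
  exact (IsLocalRing.maximalIdeal.isMaximal _).ne_top

end Unramified

end Break

end LocalKummer

namespace LocalKummer

open scoped IntermediateField

/-! ### Counting lines in an elementary abelian group -/

section Counting

/-- Counting the fibres of a map which identifies two nontrivial elements of an elementary abelian
`l`-group exactly when they generate the same subgroup. -/
theorem ncard_image_diff {G X : Type*} [CommGroup G] {l : ℕ} [Fact l.Prime]
    (hG : ∀ x : G, x ^ l = 1) (Φ : G → X)
    (hΦ : ∀ x y : G, x ≠ 1 → y ≠ 1 → (Φ x = Φ y ↔ y ∈ Subgroup.zpowers x))
    (H₁ H₂ : Subgroup G) (h : H₂ ≤ H₁) [Finite H₁] :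
    (Φ '' ((H₁ : Set G) \ H₂)).Finite ∧
      (l - 1) * (Φ '' ((H₁ : Set G) \ H₂)).ncard + Nat.card H₂ = Nat.card H₁ := by
  classical
  have hfin : ((H₁ : Set G) \ H₂).Finite := Set.Finite.sdiff (Set.toFinite (H₁ : Set G))
  refine ⟨hfin.image _, ?_⟩
  have hne : ∀ x ∈ (H₁ : Set G) \ H₂, x ≠ 1 := fun x hx h1 => hx.2 (h1 ▸ H₂.one_mem)
  have hcard : ((H₁ : Set G) \ H₂).ncard + Nat.card H₂ = Nat.card H₁ := by
    have := Set.ncard_sdiff_add_ncard_of_subset (s := (H₂ : Set G)) (t := H₁) h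
      (Set.toFinite (H₁ : Set G))
    rwa [← Nat.card_coe_set_eq, ← Nat.card_coe_set_eq, ← Nat.card_coe_set_eq] at this
  rw [← hcard]
  congr 1
  have hS := Finset.card_eq_sum_card_image Φ hfin.toFinset
  rw [Finset.sum_const_nat (m := l - 1)] at hS
  · rw [Set.ncard_eq_toFinset_card _ hfin, hS, mul_comm, ← Set.ncard_coe_finset, Finset.coe_image,
      Set.Finite.coe_toFinset]
  · intro b hb
    obtain ⟨x, hx, rfl⟩ := Finset.mem_image.1 hb
    rw [Set.Finite.mem_toFinset] at hx
    have hx1 := hne x hx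
    -- A line through x ∈ H₁ \ H₂ lies in H₁ and meets H₂ trivially, so the fibre is the whole line
    -- without 1 and has l - 1 elements.
    have hfib : (({a ∈ hfin.toFinset | Φ a = Φ x} : Finset G) : Set G) =
        (Subgroup.zpowers x : Set G) \ {1} := by
      ext y
      simp only [Finset.coe_filter, Set.Finite.mem_toFinset, Set.mem_ofPred_eq, Set.mem_sdiff,
        SetLike.mem_coe, Set.mem_singleton_iff]
      constructor
      · rintro ⟨hy, hyx⟩
        exact ⟨(hΦ x y hx1 (hne y hy)).1 hyx.symm, hne y hy⟩
      · rintro ⟨hy, hy1⟩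
        have hxy := (hΦ x y hx1 hy1).2 hy
        refine ⟨⟨Subgroup.zpowers_le.2 hx.1 hy, fun hy2 => hx.2 ?_⟩, hxy.symm⟩
        exact Subgroup.zpowers_le.2 hy2 ((hΦ y x hy1 hx1).1 hxy.symm)
    have hord : orderOf x = l := orderOf_eq_prime (hG x) hx1
    have hz : Nat.card (Subgroup.zpowers x) = l := by rw [Nat.card_zpowers, hord]
    have : Finite (Subgroup.zpowers x) :=
      Nat.finite_of_card_ne_zero (hz ▸ (Fact.out : l.Prime).ne_zero)
    rw [← Set.ncard_coe_finset, hfib, Set.ncard_sdiff_singleton_of_mem (Subgroup.one_mem _),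
      ← Nat.card_coe_set_eq]
    exact congrArg (· - 1) hz

end Counting

/-! ### Kummer theory in degree `l` -/

section Kummer

variable {l : ℕ} [Fact l.Prime] {K : Type*} [Field K]

theorem notMem_powers_iff {a : Kˣ} : a ∉ powers l K ↔ ∀ b : K, b ^ l ≠ a := by
  have hlp : l.Prime := Fact.out
  rw [not_iff_comm]
  push Not
  constructor
  · rintro ⟨b, hb⟩
    have hb0 : b ≠ 0 := by
      rintro rfl
      rw [zero_pow hlp.ne_zero] at hb
      exact a.ne_zero hb.symm
    exact ⟨Units.mk0 b hb0, Units.ext hb⟩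
  · rintro ⟨b, hb⟩
    exact ⟨b, by rw [← hb]; rfl⟩

section Root

variable {Ω : Type*} [Field Ω] [Algebra K Ω] {a : Kˣ} {α : Ω} (hα : α ^ l = algebraMap K Ω a)

include hα in
theorem root_ne_zero : α ≠ 0 := by
  rintro rfl
  rw [zero_pow (Fact.out : l.Prime).ne_zero] at hα
  exact (map_ne_zero _).2 a.ne_zero hα.symm

include hα in
theorem isIntegral_root : IsIntegral K α :=
  IsIntegral.of_pow (Fact.out : l.Prime).pos (hα ▸ isIntegral_algebraMap)

variable (ha : a ∉ powers l K)

include hα ha in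
theorem finrank_adjoin_root : Module.finrank K K⟮α⟯ = l := by
  have hlp : l.Prime := Fact.out
  have hirr := X_pow_sub_C_irreducible_of_prime hlp (notMem_powers_iff.1 ha)
  have hmin : Polynomial.X ^ l - Polynomial.C (a : K) = minpoly K α :=
    minpoly.eq_of_irreducible_of_monic hirr (by simp [hα])
      (Polynomial.monic_X_pow_sub_C _ hlp.ne_zero)
  rw [IntermediateField.adjoin.finrank (isIntegral_root hα), ← hmin,
    Polynomial.natDegree_X_pow_sub_C]

variable {ζ : K} (hζ : IsPrimitiveRoot ζ l)

include hα ha hζ in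
theorem isGalois_adjoin_root : IsGalois K K⟮α⟯ := by
  have hlp : l.Prime := Fact.out
  have hfin := finrank_adjoin_root hα ha
  have : FiniteDimensional K K⟮α⟯ := IntermediateField.adjoin.finiteDimensional (isIntegral_root hα)
  have hK : (primitiveRoots (Module.finrank K K⟮α⟯) K).Nonempty :=
    ⟨ζ, by rw [hfin, mem_primitiveRoots hlp.pos]; exact hζ⟩
  have hgen : (IntermediateField.AdjoinSimple.gen K α) ^ (Module.finrank K K⟮α⟯) =
      algebraMap K K⟮α⟯ a := by
    rw [hfin]
    exact Subtype.ext hα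
  have htop : K⟮IntermediateField.AdjoinSimple.gen K α⟯ = ⊤ :=
    IntermediateField.lift_injective _ (by
      rw [IntermediateField.lift_adjoin_simple, IntermediateField.lift_top]
      rfl)
  have := isSplittingField_X_pow_sub_C_of_root_adjoin_eq_top hK hgen htop
  exact isGalois_of_isSplittingField_X_pow_sub_C hK
    (irreducible_X_pow_sub_C_of_root_adjoin_eq_top hgen htop) _

end Root

theorem algEquiv_gen_ne {Ω : Type*} [Field Ω] [Algebra K Ω] {α : Ω} {σ : Gal(K⟮α⟯/K)}
    (hσ : σ ≠ 1) :
    σ (IntermediateField.AdjoinSimple.gen K α) ≠ IntermediateField.AdjoinSimple.gen K α := by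
  intro h
  apply hσ
  have : (σ : K⟮α⟯ →ₐ[K] K⟮α⟯) = AlgHom.id K K⟮α⟯ :=
    IntermediateField.algHom_ext_of_eq_adjoin _ rfl (by
      rintro x (rfl : x = α)
      exact h)
  ext x
  exact congrArg Subtype.val (DFunLike.congr_fun this x)

variable {ζ : K} (hζ : IsPrimitiveRoot ζ l)

include hζ in
/-- The `l`-th roots of unity of an extension of `K` are in `K`. -/
theorem exists_algebraMap_eq_of_pow_eq_one {Ω : Type*} [Field Ω] [Algebra K Ω] {ξ : Ω}
    (hξ : ξ ^ l = 1) : ∃ x : K, x ≠ 0 ∧ algebraMap K Ω x = ξ := by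
  have : NeZero l := ⟨(Fact.out : l.Prime).ne_zero⟩
  obtain ⟨i, -, rfl⟩ := (hζ.map_of_injective (algebraMap K Ω).injective).eq_pow_of_pow_eq_one hξ
  exact ⟨ζ ^ i, pow_ne_zero _ (hζ.ne_zero NeZero.out), map_pow _ _ _⟩

section AlgClosure

variable {Ω : Type*} [Field Ω] [Algebra K Ω]

-- From b = a ^ k c ^ l, the quotient β / (α ^ k c) is an `l`-th root of unity, hence lies in `K`.
include hζ in
theorem mem_adjoin_root_of_mem_zpowers {a b : Kˣ} {α β : Ω} (hα : α ^ l = algebraMap K Ω a)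
    (hβ : β ^ l = algebraMap K Ω b)
    (h : (b : Kˣ ⧸ powers l K) ∈ Subgroup.zpowers (a : Kˣ ⧸ powers l K)) : β ∈ K⟮α⟯ := by
  obtain ⟨k, hk⟩ := h
  obtain ⟨c, hc⟩ := QuotientGroup.eq.1 (hk : ((a ^ k : Kˣ) : Kˣ ⧸ powers l K) = b)
  have hα0 := root_ne_zero hα
  have hbc : (b : K) = (a : K) ^ k * (c : K) ^ l := by
    have : b = a ^ k * c ^ l := by
      rw [powMonoidHom_apply] at hc
      rw [hc, mul_inv_cancel_left]
    rw [this]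
    push_cast
    rfl
  have hc0 : algebraMap K Ω c ≠ 0 := (map_ne_zero _).2 c.ne_zero
  have hξ : (β / (α ^ k * algebraMap K Ω c)) ^ l = 1 := by
    rw [div_pow, mul_pow, ← zpow_natCast (α ^ k), ← zpow_mul, mul_comm k, zpow_mul, zpow_natCast,
      hα, hβ, hbc, map_mul, map_zpow₀, map_pow, div_self]
    exact mul_ne_zero (zpow_ne_zero _ ((map_ne_zero _).2 a.ne_zero)) (pow_ne_zero _ hc0)
  obtain ⟨x, -, hx⟩ := exists_algebraMap_eq_of_pow_eq_one hζ hξ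
  have : β = algebraMap K Ω x * (α ^ k * algebraMap K Ω c) := by
    rw [hx, div_mul_cancel₀]
    exact mul_ne_zero (zpow_ne_zero _ hα0) hc0
  rw [this]
  exact mul_mem (IntermediateField.algebraMap_mem _ _) (mul_mem
    (zpow_mem (IntermediateField.mem_adjoin_simple_self K α) _)
    (IntermediateField.algebraMap_mem _ _))

-- For a generator σ of the Galois group, σ α / α is a primitive root of unity, so σ β / β = (σ α /
-- α) ^ k for some k. Then β / α ^ k is fixed and equals some c in `K`, whence b = c ^ l a ^ k.
include hζ in
theorem mem_zpowers_of_adjoin_root_eq {a b : Kˣ} {α β : Ω} (hα : α ^ l = algebraMap K Ω a)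
    (hβ : β ^ l = algebraMap K Ω b) (ha : a ∉ powers l K) (h : K⟮α⟯ = K⟮β⟯) :
    (b : Kˣ ⧸ powers l K) ∈ Subgroup.zpowers (a : Kˣ ⧸ powers l K) := by
  have hlp : l.Prime := Fact.out
  have : NeZero l := ⟨hlp.ne_zero⟩
  have hfin := finrank_adjoin_root hα ha
  have : FiniteDimensional K K⟮α⟯ := IntermediateField.adjoin.finiteDimensional (isIntegral_root hα)
  have := isGalois_adjoin_root hα ha hζ
  have hcard : Nat.card Gal(K⟮α⟯/K) = l := by rw [IsGalois.card_aut_eq_finrank, hfin]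
  have : Nontrivial Gal(K⟮α⟯/K) := by
    have : Finite Gal(K⟮α⟯/K) := Nat.finite_of_card_ne_zero (hcard ▸ hlp.ne_zero)
    rw [← Finite.one_lt_card_iff_nontrivial, hcard]
    exact hlp.one_lt
  obtain ⟨σ, hσ⟩ := exists_ne (1 : Gal(K⟮α⟯/K))
  have hσtop := zpowers_eq_top_of_prime_card hcard hσ
  set x := IntermediateField.AdjoinSimple.gen K α with hx
  let y : K⟮α⟯ := ⟨β, h ▸ IntermediateField.mem_adjoin_simple_self K β⟩
  have hxl : x ^ l = algebraMap K K⟮α⟯ a := Subtype.ext hα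
  have hyl : y ^ l = algebraMap K K⟮α⟯ b := Subtype.ext hβ
  have hx0 := root_ne_zero hxl
  have hy0 := root_ne_zero hyl
  have hroot : ∀ {c : Kˣ} {z : K⟮α⟯}, z ^ l = algebraMap K K⟮α⟯ c → (σ z / z) ^ l = 1 := by
    intro c z hz
    rw [div_pow, ← map_pow, hz, AlgEquiv.commutes, div_self]
    exact (map_ne_zero _).2 c.ne_zero
  have hξ := hroot hxl
  have hξ1 : σ x / x ≠ 1 := fun h => algEquiv_gen_ne hσ ((div_eq_one_iff_eq hx0).1 h)
  have hprim : IsPrimitiveRoot (σ x / x) l := IsPrimitiveRoot.iff_orderOf.2 (orderOf_eq_prime hξ hξ1)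
  obtain ⟨k, -, hk⟩ := hprim.eq_pow_of_pow_eq_one (hroot hyl)
  have hfix : σ (y / x ^ k) = y / x ^ k := by
    have h1 : σ y = (σ x / x) ^ k * y := by rw [hk, div_mul_cancel₀ _ hy0]
    have h2 : σ x ≠ 0 := (map_ne_zero _).2 hx0
    rw [map_div₀, map_pow, h1, div_pow]
    field_simp
  obtain ⟨c, hc⟩ := (IsGalois.mem_range_algebraMap_iff_fixed (y / x ^ k)).2 fun τ => by
    have hτ : τ ∈ Subgroup.zpowers σ := hσtop ▸ Subgroup.mem_top τ
    have hle : Subgroup.zpowers σ ≤ MulAction.stabilizer Gal(K⟮α⟯/K) (y / x ^ k) := by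
      rw [Subgroup.zpowers_le, MulAction.mem_stabilizer_iff]
      exact hfix
    exact MulAction.mem_stabilizer_iff.1 (hle hτ)
  have hc0 : c ≠ 0 := by
    rintro rfl
    rw [map_zero] at hc
    exact div_ne_zero hy0 (pow_ne_zero _ hx0) hc.symm
  refine ⟨k, ?_⟩
  refine QuotientGroup.eq.2 ⟨Units.mk0 c hc0, ?_⟩
  have hyc : y = algebraMap K K⟮α⟯ c * x ^ k := by rw [hc, div_mul_cancel₀ _ (pow_ne_zero _ hx0)]
  have hbc : (b : K) = c ^ l * (a : K) ^ k := by
    apply (algebraMap K K⟮α⟯).injective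
    rw [← hyl, hyc, mul_pow, ← pow_mul, mul_comm k, pow_mul, hxl, map_mul, map_pow, map_pow]
  rw [powMonoidHom_apply, eq_inv_mul_iff_mul_eq]
  dsimp only
  rw [zpow_natCast]
  apply Units.ext
  push_cast
  rw [Units.val_mk0, hbc, mul_comm]

end AlgClosure

/-- The extension of `K` generated by the `l`-th roots of a representative of a class modulo
`l`-th powers. -/
noncomputable def kummerField (l : ℕ) [Fact l.Prime] (K : Type*) [Field K] (x : Kˣ ⧸ powers l K) :
    IntermediateField K (AlgebraicClosure K) :=
  K⟮(IsAlgClosed.exists_pow_nat_eq (algebraMap K (AlgebraicClosure K) (x.out : Kˣ))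
    (Fact.out : l.Prime).pos).choose⟯

-- Neither the representative nor the root chosen in `kummerField` matters.
include hζ in
theorem kummerField_mk {a : Kˣ} {α : AlgebraicClosure K}
    (hα : α ^ l = algebraMap K (AlgebraicClosure K) a) :
    kummerField l K (a : Kˣ ⧸ powers l K) = K⟮α⟯ := by
  have hβ := (IsAlgClosed.exists_pow_nat_eq (algebraMap K (AlgebraicClosure K)
    ((a : Kˣ ⧸ powers l K).out : Kˣ)) (Fact.out : l.Prime).pos).choose_spec
  have heq : (((a : Kˣ ⧸ powers l K).out : Kˣ) : Kˣ ⧸ powers l K) = a := Quotient.out_eq' _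
  apply le_antisymm
  · rw [kummerField, IntermediateField.adjoin_simple_le_iff]
    exact mem_adjoin_root_of_mem_zpowers hζ hα hβ (by
      rw [heq]
      exact Subgroup.mem_zpowers _)
  · rw [kummerField, IntermediateField.adjoin_simple_le_iff]
    refine mem_adjoin_root_of_mem_zpowers hζ hβ hα ?_
    rw [heq]
    exact Subgroup.mem_zpowers _

theorem quotient_powers_pow_eq_one {l : ℕ} {K : Type*} [Field K] (x : Kˣ ⧸ powers l K) : x ^ l = 1 := by
  induction x using QuotientGroup.induction_on with
  | H a => exact (QuotientGroup.eq_one_iff (a ^ l)).2 ⟨a, rfl⟩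

include hζ in
theorem kummerField_eq_iff (x y : Kˣ ⧸ powers l K) (hx : x ≠ 1) (hy : y ≠ 1) :
    kummerField l K x = kummerField l K y ↔ y ∈ Subgroup.zpowers x := by
  have hlp : l.Prime := Fact.out
  induction x using QuotientGroup.induction_on with
  | H a =>
  induction y using QuotientGroup.induction_on with
  | H b =>
  obtain ⟨α, hα⟩ := IsAlgClosed.exists_pow_nat_eq (algebraMap K (AlgebraicClosure K) a) hlp.pos
  obtain ⟨β, hβ⟩ := IsAlgClosed.exists_pow_nat_eq (algebraMap K (AlgebraicClosure K) b) hlp.pos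
  have ha : a ∉ powers l K := fun h => hx ((QuotientGroup.eq_one_iff a).2 h)
  have hb : b ∉ powers l K := fun h => hy ((QuotientGroup.eq_one_iff b).2 h)
  rw [kummerField_mk hζ hα, kummerField_mk hζ hβ]
  refine ⟨mem_zpowers_of_adjoin_root_eq hζ hα hβ ha, fun h => ?_⟩
  have : FiniteDimensional K K⟮α⟯ := IntermediateField.adjoin.finiteDimensional (isIntegral_root hα)
  refine (IntermediateField.eq_of_le_of_finrank_eq ?_ ?_).symm
  · rw [IntermediateField.adjoin_simple_le_iff]
    exact mem_adjoin_root_of_mem_zpowers hζ hα hβ h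
  · rw [finrank_adjoin_root hα ha, finrank_adjoin_root hβ hb]

include hζ in
theorem isKummer_iff (L : IntermediateField K (AlgebraicClosure K)) :
    IsKummer l L ↔ ∃ x : Kˣ ⧸ powers l K, x ≠ 1 ∧ kummerField l K x = L := by
  have hlp : l.Prime := Fact.out
  constructor
  · rintro ⟨hfin, α, ⟨a, ha⟩, rfl⟩
    have hne : ∀ b : K, b ^ l ≠ a := by
      rintro b rfl
      have hroot : α ∈ (⊥ : IntermediateField K (AlgebraicClosure K)) := by
        rw [map_pow] at ha
        by_cases hb : b = 0
        · rw [hb, map_zero, zero_pow hlp.ne_zero, eq_comm, pow_eq_zero_iff hlp.ne_zero] at ha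
          rw [ha]
          exact zero_mem _
        · have hb' : algebraMap K (AlgebraicClosure K) b ≠ 0 := (map_ne_zero _).2 hb
          obtain ⟨x, -, hx⟩ := exists_algebraMap_eq_of_pow_eq_one hζ
            (ξ := α / algebraMap K (AlgebraicClosure K) b) (by
              rw [div_pow, ← ha, div_self (pow_ne_zero _ hb')])
          rw [eq_div_iff hb'] at hx
          rw [← hx]
          exact mul_mem (IntermediateField.algebraMap_mem _ _)
            (IntermediateField.algebraMap_mem _ _)
      rw [IntermediateField.finrank_adjoin_simple_eq_one_iff.2 hroot] at hfin
      exact hlp.one_lt.ne hfin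
    have ha0 : a ≠ 0 := by
      rintro rfl
      exact hne 0 (zero_pow hlp.ne_zero)
    have hnot : Units.mk0 a ha0 ∉ powers l K := notMem_powers_iff.2 hne
    exact ⟨(Units.mk0 a ha0 : Kˣ ⧸ powers l K),
      fun h => hnot ((QuotientGroup.eq_one_iff _).1 h), kummerField_mk hζ ha.symm⟩
  · rintro ⟨x, hx, rfl⟩
    induction x using QuotientGroup.induction_on with
    | H a =>
    obtain ⟨α, hα⟩ := IsAlgClosed.exists_pow_nat_eq (algebraMap K (AlgebraicClosure K) a) hlp.pos
    have ha : a ∉ powers l K := fun h => hx ((QuotientGroup.eq_one_iff a).2 h)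
    rw [kummerField_mk hζ hα]
    exact ⟨finrank_adjoin_root hα ha, α, ⟨a, hα.symm⟩, rfl⟩

end Kummer

end LocalKummer

/-! ### Ramification of the extension attached to a class modulo `l`-th powers -/

namespace LocalKummer

open scoped IntermediateField

instance isAlgebraic_intermediateField (l : ℕ) [Fact l.Prime] (K : Type*) [Field K]
    [Algebra ℚ_[l] K] [Algebra.IsAlgebraic ℚ_[l] K]
    (L : IntermediateField K (AlgebraicClosure K)) : Algebra.IsAlgebraic ℚ_[l] L :=
  Algebra.IsAlgebraic.trans ℚ_[l] K L

theorem gen_pow_eq {l : ℕ} {K : Type*} [Field K] {a : K} {α : AlgebraicClosure K}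
    (hα : α ^ l = algebraMap K (AlgebraicClosure K) a) :
    (IntermediateField.AdjoinSimple.gen K α) ^ l = algebraMap K K⟮α⟯ a :=
  Subtype.ext hα

section KummerBreak

variable {l : ℕ} [Fact l.Prime] {K : Type*} [Field K] [Algebra ℚ_[l] K] [Algebra ℤ_[l] K]
  [IsScalarTower ℤ_[l] ℚ_[l] K] [FiniteDimensional ℚ_[l] K] {ϖ : K} (hϖ : IsUniformizer l K ϖ)
  {ζ : K} (hζ : IsPrimitiveRoot ζ l) {m : ℕ} (hm : absVal l K (ζ - 1) = absVal l K ϖ ^ m)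
  (hm1 : 1 ≤ m)

section Root

variable {L : Type*} [Field L] [Algebra K L] [Algebra ℚ_[l] L] [IsScalarTower ℚ_[l] K L]
  [Algebra.IsAlgebraic ℚ_[l] L] [FiniteDimensional K L] [IsGalois K L] {a : Kˣ} {x : L}
  (hx : x ^ l = algebraMap K L a)

include hx in
theorem absVal_root_pow_eq : absVal l L x ^ l = absVal l K a := by
  rw [← map_pow, hx, absVal_algebraMap]

include hζ in
theorem absVal_prime_eq_of_algebra : absVal l L (l : L) = absVal l K (ζ - 1) ^ (l - 1) := by
  rw [← map_natCast (algebraMap K L), absVal_algebraMap,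
    absVal_prime_eq (isNonarchimedean_absVal l K) hζ]

variable (hfix : ∀ σ : Gal(L/K), σ ≠ 1 → σ x ≠ x)

include hx hζ hfix in
theorem absVal_algEquiv_div_sub_one {σ : Gal(L/K)} (hσ : σ ≠ 1) :
    absVal l L (σ x / x - 1) = absVal l K (ζ - 1) := by
  have h0 := root_ne_zero hx
  rw [absVal_root_sub_one (isNonarchimedean_absVal l L)
    (hζ.map_of_injective (algebraMap K L).injective), ← map_one (algebraMap K L),
    ← map_sub (algebraMap K L), absVal_algebraMap]
  · rw [div_pow, ← map_pow, hx, AlgEquiv.commutes, div_self]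
    exact (map_ne_zero _).2 a.ne_zero
  · exact fun h => hfix σ hσ ((div_eq_one_iff_eq h0).1 h)

include hϖ hζ hm hm1 hx hfix in
/-- Adjoining an `l`-th root of an element of valuation prime to `l`. -/
theorem hasRamificationBreak_of_root_of_isCoprime (hfin : Module.finrank K L = l) {k : ℤ}
    (hk : IsCoprime k (l : ℤ)) (hak : absVal l K a = absVal l K ϖ ^ k) :
    HasRamificationBreak l K L (l * m : ℕ) ∧
      discrVal l K L = ((l - 1) * (1 + l * m) : ℕ) := by
  have hlp : l.Prime := Fact.out
  -- Here β is the root x itself, and |σ x / x - 1| ^ l = |ζ - 1| ^ l = |ϖ| ^ (l m).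
  refine hasRamificationBreak_and_discrVal hϖ hfin hk
    ((absVal_root_pow_eq hx).trans hak) (Nat.mul_pos hlp.pos hm1) fun σ hσ => ?_
  rw [absVal_algEquiv_div_sub_one hζ hx hfix hσ, hm, ← pow_mul, mul_comm]

include hϖ hζ hm hm1 hx hfix in
/-- Adjoining an `l`-th root of a unit at a level prime to `l`. -/
theorem hasRamificationBreak_of_root_of_unit (hfin : Module.finrank K L = l) {n : ℕ} (hn1 : 1 ≤ n)
    (hn : n < l * m) (hln : ¬ l ∣ n) (han : absVal l K ((a : K) - 1) = absVal l K ϖ ^ n) :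
    HasRamificationBreak l K L (l * m - n : ℕ) ∧
      discrVal l K L = ((l - 1) * (1 + (l * m - n)) : ℕ) := by
  have hlp : l.Prime := Fact.out
  have hv := isNonarchimedean_absVal l L
  have hc := absVal_zeta_sub_one_lt hϖ hm hm1
  have hl := absVal_prime_eq_of_algebra (l := l) (L := L) hζ
  have hxa : absVal l L ((1 + (x - 1)) ^ l - 1) = absVal l K ϖ ^ n := by
    rw [add_sub_cancel, hx, ← map_one (algebraMap K L), ← map_sub (algebraMap K L),
      absVal_algebraMap, han]
  have hlt : absVal l K ϖ ^ (l * m) < absVal l K ϖ ^ n :=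
    pow_lt_pow_right_of_lt_one₀ hϖ.1 hϖ.2.1 hn
  -- Otherwise |a - 1| ≤ |ζ - 1| ^ l = |ϖ| ^ (l m), against n < l m. Above the threshold |x - 1| ^ l
  -- = |a - 1|, so x - 1 has valuation n, prime to `l`, and serves as β.
  have hcx : absVal l K (ζ - 1) < absVal l L (x - 1) := by
    by_contra! h
    have h1 := (absVal_one_add_pow_sub_one_le hv hc hl h).trans
      (mul_le_mul_of_nonneg_left h (pow_nonneg ((absVal l K).nonneg _) _))
    rw [hxa, ← pow_succ, Nat.sub_add_cancel hlp.one_lt.le, hm, ← pow_mul, mul_comm m] at h1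
    exact absurd hlt (not_lt.2 h1)
  have hβ : absVal l L (x - 1) ^ l = absVal l K ϖ ^ n := by
    rw [← absVal_one_add_pow_sub_one_of_lt hv hc hl ((absVal l K).nonneg _) hcx, hxa]
  have hx1 : absVal l L x = 1 := by
    have h1 : absVal l K (a : K) = 1 := by
      apply absVal_eq_one_of_sub_one_lt
      rw [han]
      exact pow_lt_one₀ hϖ.1.le hϖ.2.1 (by omega)
    have h2 := absVal_root_pow_eq hx
    rw [h1] at h2
    exact (pow_eq_one_iff_of_nonneg ((absVal l L).nonneg _) hlp.ne_zero).1 h2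
  have hcop : IsCoprime (n : ℤ) (l : ℤ) :=
    Nat.isCoprime_iff_coprime.2 ((Nat.Prime.coprime_iff_not_dvd hlp).2 hln).symm
  refine hasRamificationBreak_and_discrVal hϖ hfin hcop
    (by rw [hβ, zpow_natCast]) (by omega) fun σ hσ => ?_
  have hβ0 : x - 1 ≠ 0 :=
    (absVal l L).pos_iff.1 (((absVal l K).nonneg _).trans_lt hcx)
  have hx0 : x ≠ 0 := (absVal l L).pos_iff.1 (by rw [hx1]; exact one_pos)
  -- The right side has size |ζ - 1| / |x - 1|, whose `l`-th power is |ϖ| ^ (l m - n): this is where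
  -- the break l m - n comes from.
  have h3 : σ (x - 1) / (x - 1) - 1 = (σ x / x - 1) * x / (x - 1) := by
    rw [map_sub, map_one]
    field_simp
    ring
  rw [h3, map_div₀, map_mul, absVal_algEquiv_div_sub_one hζ hx hfix hσ, hx1, mul_one, div_pow,
    hβ, hm, ← pow_mul, mul_comm m, div_eq_iff (pow_pos hϖ.1 _).ne', ← pow_add,
    Nat.sub_add_cancel hn.le]

include hϖ hζ hm hm1 hx hfix in
/-- Adjoining an `l`-th root of a unit close to `1`. -/
theorem unramified_of_root (han : absVal l K ((a : K) - 1) ≤ absVal l K ϖ ^ (l * m)) :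
    ramificationGroup l K L 0 = ⊥ ∧ discrVal l K L = 0 := by
  have hlp : l.Prime := Fact.out
  have hv := isNonarchimedean_absVal l L
  have hc := absVal_zeta_sub_one_lt hϖ hm hm1
  have hc0 : 0 < absVal l K (ζ - 1) := by
    rw [hm]
    exact pow_pos hϖ.1 m
  have hl := absVal_prime_eq_of_algebra (l := l) (L := L) hζ
  have hxc : absVal l L (x - 1) ≤ absVal l K (ζ - 1) := by
    by_contra! h
    have h1 := absVal_one_add_pow_sub_one_of_lt hv hc hl hc0.le h
    have h2 := pow_lt_pow_left₀ h hc0.le hlp.ne_zero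
    rw [← h1, add_sub_cancel, hx, ← map_one (algebraMap K L), ← map_sub (algebraMap K L),
      absVal_algebraMap, hm, ← pow_mul, mul_comm m] at h2
    exact absurd h2 (not_lt.2 han)
  have hx1 : absVal l L x = 1 := absVal_eq_one_of_sub_one_lt (hxc.trans_lt hc)
  have hx0 : x ≠ 0 := (absVal l L).pos_iff.1 (by rw [hx1]; exact one_pos)
  have hζ0 : algebraMap K L (ζ - 1) ≠ 0 := (map_ne_zero _).2 ((absVal l K).pos_iff.1 hc0)
  have hβ : absVal l L ((x - 1) / algebraMap K L (ζ - 1)) ≤ 1 := by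
    rw [map_div₀, absVal_algebraMap]
    exact div_le_one_of_le₀ hxc hc0.le
  -- Dividing x - 1 by ζ - 1 keeps it integral and turns the displacement |σ x - x| = |ζ - 1| into
  -- 1.
  have hσ : ∀ σ : Gal(L/K), σ ≠ 1 → absVal l L (σ ((x - 1) / algebraMap K L (ζ - 1)) -
      (x - 1) / algebraMap K L (ζ - 1)) = 1 := by
    intro σ hσ
    have h3 : σ ((x - 1) / algebraMap K L (ζ - 1)) - (x - 1) / algebraMap K L (ζ - 1) =
        (σ x / x - 1) * x / algebraMap K L (ζ - 1) := by
      rw [map_div₀ σ, AlgEquiv.commutes, map_sub σ, map_one]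
      field_simp
      ring
    rw [h3, map_div₀, map_mul, absVal_algEquiv_div_sub_one hζ hx hfix hσ, hx1, mul_one,
      absVal_algebraMap, div_self hc0.ne']
  exact ⟨ramificationGroup_zero_eq_bot hβ hσ, discrVal_eq_zero hβ hσ⟩

end Root

/-- The filtration of `Kˣ / (Kˣ) ^ l` by the images of the unit groups. -/
def quotientFiltration (l : ℕ) [Fact l.Prime] {K : Type*} [Field K] [Algebra ℚ_[l] K]
    [Algebra.IsAlgebraic ℚ_[l] K] (ϖ : K) : ℕ → Subgroup (Kˣ ⧸ powers l K)
  | 0 => ⊤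
  | n + 1 => (unitFiltration l K ϖ (n + 1)).map (QuotientGroup.mk' (powers l K))

/-- Level 0 is the exception: it is the whole group and not the image of the units, so that the step
from 0 to 1 holds the classes of valuation prime to `l`. -/
theorem quotientFiltration_of_pos {n : ℕ} (hn : 1 ≤ n) : quotientFiltration l ϖ n =
    (unitFiltration l K ϖ n).map (QuotientGroup.mk' (powers l K)) := by
  obtain ⟨k, rfl⟩ := Nat.exists_eq_add_of_le' hn
  rfl

include hϖ in
theorem quotientFiltration_antitone : Antitone (quotientFiltration l ϖ) := by
  refine antitone_nat_of_succ_le fun n => ?_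
  rcases n with _ | n
  · exact le_top
  · exact Subgroup.map_mono (unitFiltration_antitone hϖ.2.1.le (Nat.le_succ _))

theorem card_map_mk_powers (H : Subgroup Kˣ) :
    Nat.card (H.map (QuotientGroup.mk' (powers l K))) = (powers l K).relIndex H := by
  have h := Subgroup.relIndex_ker (QuotientGroup.mk' (powers l K)) (K := H)
  rw [QuotientGroup.ker_mk'] at h
  exact h.symm

/-- The valuation modulo `l`. -/
noncomputable def valuationMod (hϖ : IsUniformizer l K ϖ) : Kˣ →* Multiplicative (ZMod l) :=
  MonoidHom.mk' (fun a => Multiplicative.ofAdd ((hϖ.2.2 (a : K) a.ne_zero).choose : ZMod l))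
    fun a b => by
      rw [← ofAdd_add, ← Int.cast_add]
      congr 2
      apply zpow_right_injective₀ hϖ.1 hϖ.2.1.ne
      simp only
      rw [zpow_add₀ hϖ.1.ne', ← (hϖ.2.2 _ (a * b : Kˣ).ne_zero).choose_spec,
        ← (hϖ.2.2 _ a.ne_zero).choose_spec, ← (hϖ.2.2 _ b.ne_zero).choose_spec, Units.val_mul,
        map_mul]

theorem valuationMod_apply {a : Kˣ} {k : ℤ} (hk : absVal l K a = absVal l K ϖ ^ k) :
    valuationMod hϖ a = Multiplicative.ofAdd (k : ZMod l) := by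
  change Multiplicative.ofAdd ((hϖ.2.2 (a : K) a.ne_zero).choose : ZMod l) = _
  congr 2
  apply zpow_right_injective₀ hϖ.1 hϖ.2.1.ne
  simp only
  rw [← (hϖ.2.2 _ a.ne_zero).choose_spec, hk]

theorem valuationMod_surjective : Function.Surjective (valuationMod hϖ) := by
  intro y
  obtain ⟨k, hk⟩ := ZMod.intCast_surjective y.toAdd
  have hϖ0 : ϖ ≠ 0 := (absVal l K).pos_iff.1 hϖ.1
  refine ⟨Units.mk0 ϖ hϖ0 ^ k, ?_⟩
  rw [valuationMod_apply hϖ (k := k), hk]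
  · rfl
  · push_cast
    rw [Units.val_mk0, map_zpow₀]

/-- If `l` divides the valuation, dividing by one `l`-th power leaves a unit, and dividing by a
second leaves an element of U_1, the residue field being perfect. -/
theorem valuationMod_ker :
    (valuationMod hϖ).ker = unitFiltration l K ϖ 1 ⊔ powers l K := by
  apply le_antisymm
  · intro a ha
    rw [MonoidHom.mem_ker] at ha
    obtain ⟨k, hk⟩ := hϖ.2.2 (a : K) a.ne_zero
    rw [valuationMod_apply hϖ hk] at ha
    obtain ⟨j, rfl⟩ := (ZMod.intCast_zmod_eq_zero_iff_dvd k l).1 (Multiplicative.ofAdd.injective ha)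
    have hϖ0 : ϖ ≠ 0 := (absVal l K).pos_iff.1 hϖ.1
    set b := Units.mk0 ϖ hϖ0 ^ j with hb
    have hbv : absVal l K (b : K) = absVal l K ϖ ^ j := by
      rw [hb]
      push_cast
      rw [Units.val_mk0, map_zpow₀]
    have hu : absVal l K ((a * (b ^ l)⁻¹ : Kˣ) : K) = 1 := by
      push_cast
      rw [map_mul, map_inv₀, map_pow, hk, hbv, mul_comm (l : ℤ), zpow_mul, zpow_natCast,
        mul_inv_cancel₀]
      exact pow_ne_zero _ (zpow_ne_zero _ hϖ.1.ne')
    obtain ⟨y, hy⟩ := exists_pow_mul_mem_unitFiltration_one hϖ hu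
    have : a = a * (b ^ l)⁻¹ * (y ^ l)⁻¹ * (y * b) ^ l := by
      rw [mul_pow]
      group
    rw [this]
    exact Subgroup.mul_mem_sup hy ⟨y * b, rfl⟩
  · refine sup_le (fun u hu => ?_) ?_
    · rw [MonoidHom.mem_ker, valuationMod_apply hϖ (k := 0) (by rw [hu.1, zpow_zero])]
      simp
    · rintro _ ⟨y, rfl⟩
      rw [MonoidHom.mem_ker, powMonoidHom_apply, map_pow]
      apply Multiplicative.toAdd.injective
      simp

include hϖ in
theorem card_quotient_powers :
    Nat.card (Kˣ ⧸ powers l K) = l * (powers l K).relIndex (unitFiltration l K ϖ 1) := by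
  change (powers l K).index = _
  rw [← Subgroup.relIndex_mul_index (le_sup_right : powers l K ≤ unitFiltration l K ϖ 1 ⊔ powers l K),
    Subgroup.relIndex_sup_right, ← valuationMod_ker hϖ, Subgroup.index_ker,
    MonoidHom.range_eq_top.2 (valuationMod_surjective hϖ), Subgroup.card_top, mul_comm]
  congr 1
  exact Nat.card_zmod l

-- The exponent is 1 + μ(t). Levels are indexed by t = l m - n, the future break; at t = 0 the group
-- has order `l`, a single line.
include hϖ hζ hm hm1 in
theorem card_quotientFiltration_sub {t : ℕ} (ht : t < l * m) :
    Nat.card (quotientFiltration l ϖ (l * m - t)) =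
      l ^ (1 + (t - t / l) * absResDeg l K) := by
  have hlp : l.Prime := Fact.out
  rw [quotientFiltration_of_pos (by omega), card_map_mk_powers]
  have h1 : l * (t / l) + t % l = t := Nat.div_add_mod t l
  have h2 : t % l < l := Nat.mod_lt _ hlp.pos
  have h3 : t / l < m := Nat.div_lt_of_lt_mul ht
  -- Here j + 1 = m - ⌊t / l⌋ = ⌈(l m - t) / l⌉, the k of the index formula, and (l - 1) m + k - (l
  -- m - t) = t - ⌊t / l⌋.
  obtain ⟨j, hj⟩ := Nat.exists_eq_add_of_lt h3
  generalize t / l = s at *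
  have hlm : l * m = l * s + l * j + l := by
    rw [hj]
    ring
  have hlm' : l * m = (l - 1) * m + m := by
    nth_rewrite 1 [← Nat.sub_add_cancel hlp.one_lt.le]
    ring
  rw [relIndex_powers_unitFiltration hϖ hζ hm hm1 (n := l * m - t) (k := j + 1) (by omega)
    (by omega) (by rw [mul_add]; omega) (by rw [Nat.add_sub_cancel]; omega)]
  have h4 : (l - 1) * m + (j + 1) - (l * m - t) = t - s := by omega
  rw [h4, ← pow_mul, add_comm 1, pow_succ, mul_comm l, mul_comm (absResDeg l K)]

-- U_1 contributes l · l ^ (e f), and the valuation modulo `l` one more factor `l`. That extra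
-- factor explains the exceptional value μ(l e₁) = 1 + d.
include hϖ hζ hm hm1 in
theorem card_quotientFiltration_zero (he : (l - 1) * m = absRamIdx l K) :
    Nat.card (quotientFiltration l ϖ 0) = l ^ (1 + (1 + Module.finrank ℚ_[l] K)) := by
  have hlp : l.Prime := Fact.out
  change Nat.card (⊤ : Subgroup (Kˣ ⧸ powers l K)) = _
  rw [Subgroup.card_top, card_quotient_powers hϖ,
    relIndex_powers_unitFiltration hϖ hζ hm hm1 (n := 1) (k := 1) le_rfl hm1
      (by rw [mul_one]; exact hlp.one_lt.le) (by simp), Nat.add_sub_cancel, he, ← pow_mul,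
    mul_comm (absResDeg l K), absRamIdx_mul_absResDeg]
  ring

-- With n = l m - (t + 1), the quantity t - ⌊t / l⌋ does not grow on passing to a multiple t + 1 of
-- `l`; the two nested finite groups have the same order.
include hϖ hζ hm hm1 in
theorem quotientFiltration_succ_of_dvd {n : ℕ} (hn1 : 1 ≤ n) (hn : n < l * m) (hln : l ∣ n) :
    quotientFiltration l ϖ n = quotientFiltration l ϖ (n + 1) := by
  have hlp : l.Prime := Fact.out
  obtain ⟨t, ht⟩ := Nat.exists_eq_add_of_lt hn
  have hdvd : l ∣ t + 1 := by
    have : l ∣ n + (t + 1) := by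
      rw [← add_assoc, ← ht]
      exact dvd_mul_right _ _
    exact (Nat.dvd_add_right hln).1 this
  have h1 := card_quotientFiltration_sub hϖ hζ hm hm1 (t := t + 1) (by omega)
  have h2 := card_quotientFiltration_sub hϖ hζ hm hm1 (t := t) (by omega)
  have h3 : t + 1 - (t + 1) / l = t - t / l := by
    rw [Nat.succ_div_of_dvd hdvd]
    omega
  rw [h3, ← h2, show l * m - (t + 1) = n by omega, show l * m - t = n + 1 by omega] at h1
  have hfin : Finite (quotientFiltration l ϖ n) := Nat.finite_of_card_ne_zero (by
    rw [h1, show n + 1 = l * m - t by omega, h2]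
    exact pow_ne_zero _ hlp.ne_zero)
  exact (Subgroup.eq_of_le_of_card_ge (quotientFiltration_antitone hϖ (Nat.le_succ n)) h1.le).symm

-- At n = 0 the valuation of a representative is prime to `l`. At n ≥ 1 the class has a
-- representative with |a - 1| = |ϖ| ^ n exactly, and n is prime to `l` because the filtration does
-- not jump at multiples of `l`.
include hϖ hζ hm hm1 in
theorem hasRamificationBreak_kummerField {n : ℕ} (hn : n < l * m) {x : Kˣ ⧸ powers l K}
    (hx : x ∈ quotientFiltration l ϖ n) (hx' : x ∉ quotientFiltration l ϖ (n + 1)) :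
    HasRamificationBreak l K (kummerField l K x) (l * m - n : ℕ) ∧
      discrVal l K (kummerField l K x) = ((l - 1) * (1 + (l * m - n)) : ℕ) := by
  have hlp : l.Prime := Fact.out
  have hx1 : x ≠ 1 := fun h => hx' (h ▸ Subgroup.one_mem _)
  rcases Nat.eq_zero_or_pos n with rfl | hn1
  · induction x using QuotientGroup.induction_on with
    | H a =>
    have ha : a ∉ powers l K := fun h => hx1 ((QuotientGroup.eq_one_iff a).2 h)
    obtain ⟨α, hα⟩ := IsAlgClosed.exists_pow_nat_eq (algebraMap K (AlgebraicClosure K) a) hlp.pos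
    rw [kummerField_mk hζ hα]
    obtain ⟨k, hk⟩ := hϖ.2.2 (a : K) a.ne_zero
    have : FiniteDimensional K K⟮α⟯ :=
      IntermediateField.adjoin.finiteDimensional (isIntegral_root hα)
    have := isGalois_adjoin_root hα ha hζ
    refine hasRamificationBreak_of_root_of_isCoprime hϖ hζ hm hm1 (gen_pow_eq hα)
      (fun σ hσ => algEquiv_gen_ne hσ) (finrank_adjoin_root hα ha) (k := k) ?_ hk
    rw [isCoprime_comm, (Nat.prime_iff_prime_int.1 hlp).coprime_iff_not_dvd]
    intro hdvd
    apply hx'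
    have hker : a ∈ (valuationMod hϖ).ker := by
      rw [MonoidHom.mem_ker, valuationMod_apply hϖ hk,
        (ZMod.intCast_zmod_eq_zero_iff_dvd k l).2 hdvd, ofAdd_zero]
    rw [valuationMod_ker, Subgroup.mem_sup] at hker
    obtain ⟨u, hu, z, hz, rfl⟩ := hker
    refine ⟨u, hu, ?_⟩
    rw [QuotientGroup.mk'_apply, QuotientGroup.eq, inv_mul_cancel_left]
    exact hz
  · have hx0 := hx
    rw [quotientFiltration_of_pos hn1] at hx
    obtain ⟨a, ha1, rfl⟩ := hx
    have ha : a ∉ powers l K := fun h => hx1 ((QuotientGroup.eq_one_iff a).2 h)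
    obtain ⟨α, hα⟩ := IsAlgClosed.exists_pow_nat_eq (algebraMap K (AlgebraicClosure K) a) hlp.pos
    rw [QuotientGroup.mk'_apply, kummerField_mk hζ hα]
    have hnot : ¬ absVal l K ((a : K) - 1) ≤ absVal l K ϖ ^ (n + 1) := fun h =>
      hx' ⟨a, ⟨ha1.1, h⟩, rfl⟩
    have : FiniteDimensional K K⟮α⟯ :=
      IntermediateField.adjoin.finiteDimensional (isIntegral_root hα)
    have := isGalois_adjoin_root hα ha hζ
    refine hasRamificationBreak_of_root_of_unit hϖ hζ hm hm1 (gen_pow_eq hα)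
      (fun σ hσ => algEquiv_gen_ne hσ) (finrank_adjoin_root hα ha) hn1 hn (fun hln => hx' ?_) ?_
    · rw [← quotientFiltration_succ_of_dvd hϖ hζ hm hm1 hn1 hn hln]
      exact hx0
    · have h0 : (a : K) - 1 ≠ 0 := by
        intro h0
        rw [h0, map_zero] at hnot
        exact hnot (pow_pos hϖ.1 _).le
      obtain ⟨k, hk⟩ := hϖ.2.2 _ h0
      have h1 := ha1.2
      rw [hk, zpow_le_pow_iff hϖ.1 hϖ.2.1] at hnot h1
      push_cast at hnot
      rw [hk, show k = n by omega, zpow_natCast]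

include hϖ hζ hm hm1 in
theorem unramified_kummerField {x : Kˣ ⧸ powers l K} (hx : x ∈ quotientFiltration l ϖ (l * m))
    (hx1 : x ≠ 1) :
    ramificationGroup l K (kummerField l K x) 0 = ⊥ ∧ discrVal l K (kummerField l K x) = 0 := by
  have hlp : l.Prime := Fact.out
  rw [quotientFiltration_of_pos (Nat.mul_pos hlp.pos hm1)] at hx
  obtain ⟨a, ha1, rfl⟩ := hx
  have ha : a ∉ powers l K := fun h => hx1 ((QuotientGroup.eq_one_iff a).2 h)
  obtain ⟨α, hα⟩ := IsAlgClosed.exists_pow_nat_eq (algebraMap K (AlgebraicClosure K) a) hlp.pos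
  rw [QuotientGroup.mk'_apply, kummerField_mk hζ hα]
  have : FiniteDimensional K K⟮α⟯ :=
    IntermediateField.adjoin.finiteDimensional (isIntegral_root hα)
  have := isGalois_adjoin_root hα ha hζ
  exact unramified_of_root hϖ hζ hm hm1 (gen_pow_eq hα) (fun σ hσ => algEquiv_gen_ne hσ) ha1.2

end KummerBreak

/-! ### Uniqueness of the break -/

section Uniqueness

variable {l : ℕ} [Fact l.Prime] {K : Type*} [Field K] [Algebra ℚ_[l] K] [Algebra ℤ_[l] K]
  [IsScalarTower ℤ_[l] ℚ_[l] K] [Algebra.IsAlgebraic ℚ_[l] K]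
  {L : Type*} [Field L] [Algebra K L] [Algebra.IsAlgebraic K L]

theorem ramificationGroup_antitone : Antitone (ramificationGroup l K L) := by
  intro s t hst σ hσ x
  obtain ⟨y, hy, hy'⟩ := hσ x
  exact ⟨y, Ideal.pow_le_pow_right (by omega) hy, hy'⟩

/-- For breaks s < t, monotonicity would give G = G_t ≤ G_(s+1) = 1. -/
theorem HasRamificationBreak.eq [Nontrivial Gal(L/K)] {s t : ℤ}
    (hs : HasRamificationBreak l K L s) (ht : HasRamificationBreak l K L t) : s = t := by
  have key : ∀ {s t : ℤ}, HasRamificationBreak l K L s → HasRamificationBreak l K L t →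
      ¬ s < t := fun {s t} hs ht hst => by
    have := ramificationGroup_antitone (l := l) (K := K) (L := L) (Int.add_one_le_of_lt hst)
    rw [ht.1, hs.2] at this
    exact bot_ne_top (le_antisymm bot_le this)
  exact le_antisymm (not_lt.1 (key ht hs)) (not_lt.1 (key hs ht))

end Uniqueness

end LocalKummer

namespace LocalKummer

/-! ### The extensions with given break or discriminant, and their number -/

section KummerSets

variable {l : ℕ} [Fact l.Prime] {K : Type*} [Field K] [Algebra ℚ_[l] K] [Algebra ℤ_[l] K]
  [IsScalarTower ℤ_[l] ℚ_[l] K] [FiniteDimensional ℚ_[l] K] {ϖ : K} (hϖ : IsUniformizer l K ϖ)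
  {ζ : K} (hζ : IsPrimitiveRoot ζ l) {m : ℕ} (hm : absVal l K (ζ - 1) = absVal l K ϖ ^ m)
  (hm1 : 1 ≤ m)

theorem exists_absVal_zeta_sub_one_eq (hϖ : IsUniformizer l K ϖ) (hζ : IsPrimitiveRoot ζ l) :
    ∃ m : ℕ, 1 ≤ m ∧ absVal l K (ζ - 1) = absVal l K ϖ ^ m := by
  have hlp : l.Prime := Fact.out
  have h := absVal_prime_eq (isNonarchimedean_absVal l K) hζ
  have hl1 : absVal l K (l : K) < 1 := by
    rw [absVal_prime]
    exact inv_lt_one_of_one_lt₀ (by exact_mod_cast hlp.one_lt)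
  have hlt : absVal l K (ζ - 1) < 1 := by
    by_contra! hge
    rw [h] at hl1
    exact absurd hl1 (not_lt.2 (one_le_pow₀ hge))
  obtain ⟨k, hk⟩ := hϖ.2.2 _ (sub_ne_zero.2 (hζ.ne_one hlp.one_lt))
  rw [hk] at hlt
  have hk1 := (zpow_lt_zpow_iff_right_of_lt_one₀ hϖ.1 hϖ.2.1 (m := k) (n := 0)).1
    (by simpa using hlt)
  refine ⟨k.toNat, by omega, ?_⟩
  rw [hk, ← zpow_natCast, Int.toNat_of_nonneg hk1.le]

include hϖ hζ hm hm1 in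
/-- The possible ramification breaks and discriminants. -/
theorem exists_level_or_unramified {x : Kˣ ⧸ powers l K} (hx1 : x ≠ 1) :
    (ramificationGroup l K (kummerField l K x) 0 = ⊥ ∧ discrVal l K (kummerField l K x) = 0) ∨
    ∃ n, n < l * m ∧ x ∈ quotientFiltration l ϖ n ∧ x ∉ quotientFiltration l ϖ (n + 1) ∧
      HasRamificationBreak l K (kummerField l K x) (l * m - n : ℕ) ∧
      discrVal l K (kummerField l K x) = ((l - 1) * (1 + (l * m - n)) : ℕ) := by
  by_cases h : x ∈ quotientFiltration l ϖ (l * m)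
  · exact Or.inl (unramified_kummerField hϖ hζ hm hm1 h hx1)
  · right
    obtain ⟨n, hn, hxn, hxn'⟩ : ∃ n, n < l * m ∧ x ∈ quotientFiltration l ϖ n ∧
        x ∉ quotientFiltration l ϖ (n + 1) := by
      by_contra! hcon
      have : ∀ n ≤ l * m, x ∈ quotientFiltration l ϖ n := by
        intro n
        induction n with
        | zero => exact fun _ => Subgroup.mem_top x
        | succ n ih => exact fun hn => hcon n hn (ih (by omega))
      exact h (this _ le_rfl)
    exact ⟨n, hn, hxn, hxn', hasRamificationBreak_kummerField hϖ hζ hm hm1 hn hxn hxn'⟩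

theorem nontrivial_gal_of_isKummer {l : ℕ} [Fact l.Prime] {K : Type*} [Field K] {ζ : K}
    (hζ : IsPrimitiveRoot ζ l)
    {L : IntermediateField K (AlgebraicClosure K)} (hL : IsKummer l L) : Nontrivial Gal(L/K) := by
  have hlp : l.Prime := Fact.out
  obtain ⟨x, hx, rfl⟩ := (isKummer_iff hζ L).1 hL
  induction x using QuotientGroup.induction_on with
  | H a =>
  obtain ⟨α, hα⟩ := IsAlgClosed.exists_pow_nat_eq (algebraMap K (AlgebraicClosure K) a) hlp.pos
  have ha : a ∉ powers l K := fun h => hx ((QuotientGroup.eq_one_iff a).2 h)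
  rw [kummerField_mk hζ hα]
  have := IntermediateField.adjoin.finiteDimensional (isIntegral_root hα)
  have := isGalois_adjoin_root hα ha hζ
  rw [← Finite.one_lt_card_iff_nontrivial, IsGalois.card_aut_eq_finrank, finrank_adjoin_root hα ha]
  exact hlp.one_lt

-- Uniqueness of the break recovers the level from t, and an unramified extension is excluded by G_t
-- ≤ G_0 = 1.
include hϖ hζ hm hm1 in
theorem kummerWithBreak_eq_image {t : ℕ} (ht1 : 1 ≤ t) (ht : t ≤ l * m) :
    kummerWithBreak l K t = kummerField l K ''
      ((quotientFiltration l ϖ (l * m - t) : Set (Kˣ ⧸ powers l K)) \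
        quotientFiltration l ϖ (l * m - t + 1)) := by
  ext L
  constructor
  · rintro ⟨hL, hbreak⟩
    have := nontrivial_gal_of_isKummer hζ hL
    obtain ⟨x, hx1, rfl⟩ := (isKummer_iff hζ L).1 hL
    rcases exists_level_or_unramified hϖ hζ hm hm1 hx1 with ⟨h, -⟩ | ⟨n, hn, hxn, hxn', h, -⟩
    · have h1 := ramificationGroup_antitone (l := l) (K := K) (L := kummerField l K x)
        (show (0 : ℤ) ≤ t by positivity)
      rw [h, hbreak.1] at h1
      exact absurd (le_antisymm bot_le h1) bot_ne_top
    · have h1 := Nat.cast_injective (h.eq hbreak)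
      obtain rfl : n = l * m - t := by omega
      exact ⟨x, ⟨hxn, hxn'⟩, rfl⟩
  · rintro ⟨x, ⟨hx, hx'⟩, rfl⟩
    have hx1 : x ≠ 1 := fun h => hx' (h ▸ Subgroup.one_mem _)
    have h := (hasRamificationBreak_kummerField hϖ hζ hm hm1 (by omega) hx hx').1
    rw [Nat.sub_sub_self ht] at h
    exact ⟨(isKummer_iff hζ _).2 ⟨x, hx1, rfl⟩, h⟩

-- The value (l - 1)(1 + t) determines t, hence the level, and is positive, which excludes the
-- unramified extension.
include hϖ hζ hm hm1 in
theorem kummerWithDiscrVal_eq_image {t : ℕ} (ht1 : 1 ≤ t) (ht : t ≤ l * m) :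
    kummerWithDiscrVal l K ((l - 1) * (1 + t)) = kummerField l K ''
      ((quotientFiltration l ϖ (l * m - t) : Set (Kˣ ⧸ powers l K)) \
        quotientFiltration l ϖ (l * m - t + 1)) := by
  have hlp : l.Prime := Fact.out
  have hl1 : 0 < l - 1 := Nat.sub_pos_of_lt hlp.one_lt
  ext L
  constructor
  · rintro ⟨hL, hd⟩
    obtain ⟨x, hx1, rfl⟩ := (isKummer_iff hζ L).1 hL
    rcases exists_level_or_unramified hϖ hζ hm hm1 hx1 with ⟨-, h⟩ | ⟨n, hn, hxn, hxn', -, h⟩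
    · rw [hd] at h
      have h1 : (l - 1) * (1 + t) = 0 := by exact_mod_cast h
      have h2 : 0 < (l - 1) * (1 + t) := Nat.mul_pos hl1 (by omega)
      omega
    · rw [hd, Nat.cast_inj] at h
      have h1 := Nat.eq_of_mul_eq_mul_left hl1 h
      obtain rfl : n = l * m - t := by omega
      exact ⟨x, ⟨hxn, hxn'⟩, rfl⟩
  · rintro ⟨x, ⟨hx, hx'⟩, rfl⟩
    have hx1 : x ≠ 1 := fun h => hx' (h ▸ Subgroup.one_mem _)
    have h := (hasRamificationBreak_kummerField hϖ hζ hm hm1 (by omega) hx hx').2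
    rw [Nat.sub_sub_self ht] at h
    exact ⟨(isKummer_iff hζ _).2 ⟨x, hx1, rfl⟩, h⟩

theorem mu_of_lt {t : ℕ} (ht : t < l * eOne l K) : mu l K t = (t - t / l) * absResDeg l K :=
  if_neg ht.ne

theorem mu_top : mu l K (l * eOne l K) = 1 + Module.finrank ℚ_[l] K := if_pos rfl

/-- ⌊(l e₁ - 1) / l⌋ = e₁ - 1, so the factor of f is (l - 1) e₁ = e, and e f = d. -/
theorem mu_top_sub_one (he : (l - 1) * eOne l K = absRamIdx l K) (he1 : 1 ≤ eOne l K) :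
    mu l K (l * eOne l K - 1) = Module.finrank ℚ_[l] K := by
  have hlp : l.Prime := Fact.out
  have hpos : 0 < l * eOne l K := Nat.mul_pos hlp.pos he1
  rw [mu_of_lt (by omega), ← absRamIdx_mul_absResDeg l K, ← he]
  congr 1
  obtain ⟨k, hk⟩ := Nat.exists_eq_add_of_le' he1
  have h1 : l * eOne l K - 1 = l - 1 + l * k := by
    have := hlp.pos
    rw [hk, mul_add]
    omega
  rw [h1, Nat.add_mul_div_left _ _ hlp.pos, Nat.div_eq_of_lt (Nat.sub_lt hlp.pos one_pos), hk]
  obtain ⟨j, rfl⟩ := Nat.exists_eq_add_of_lt hlp.one_lt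
  have h2 : 1 + j + 1 - 1 = j + 1 := by omega
  rw [h2]
  have : j + 1 + (1 + j + 1) * k = (j + 1) * (k + 1) + k := by ring
  omega

theorem mul_geom_sum_add_one (k n : ℕ) :
    k * ∑ j ∈ Finset.range n, (k + 1) ^ j + 1 = (k + 1) ^ n := by
  induction n with
  | zero => simp
  | succ n ih =>
    rw [Finset.sum_range_succ, pow_succ, ← ih]
    ring

theorem sub_one_mul_delta {l : ℕ} (hl : 1 ≤ l) (n : ℕ) :
    (l - 1) * delta l n + 1 = l ^ (1 + n) := by
  obtain ⟨k, rfl⟩ := Nat.exists_eq_add_of_le' hl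
  rw [delta, Nat.add_sub_cancel, add_comm 1 n, mul_geom_sum_add_one]

-- The two levels have orders l ^ (1 + μ(t)) and l ^ (1 + μ(t - 1)), each line accounts for l - 1
-- classes, and l ^ (1 + n) = (l - 1) δ(n) + 1.
include hϖ hζ hm hm1 in
theorem finite_and_ncard_image (hme : m = eOne l K) (he : (l - 1) * m = absRamIdx l K)
    {t : ℕ} (ht1 : 1 ≤ t) (ht : t ≤ l * m) :
    (kummerField l K '' ((quotientFiltration l ϖ (l * m - t) : Set (Kˣ ⧸ powers l K)) \
      quotientFiltration l ϖ (l * m - t + 1))).Finite ∧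
    (kummerField l K '' ((quotientFiltration l ϖ (l * m - t) : Set (Kˣ ⧸ powers l K)) \
      quotientFiltration l ϖ (l * m - t + 1))).ncard + delta l (mu l K (t - 1)) =
        delta l (mu l K t) := by
  have hlp : l.Prime := Fact.out
  have hl1 : 0 < l - 1 := Nat.sub_pos_of_lt hlp.one_lt
  have hcard : ∀ s ≤ l * m, Nat.card (quotientFiltration l ϖ (l * m - s)) =
      l ^ (1 + mu l K s) := by
    intro s hs
    rcases hs.eq_or_lt with rfl | hs
    · rw [Nat.sub_self, card_quotientFiltration_zero hϖ hζ hm hm1 he, hme, mu_top]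
    · rw [card_quotientFiltration_sub hϖ hζ hm hm1 hs, mu_of_lt (hme ▸ hs)]
  have h0 := hcard t ht
  have h1 := hcard (t - 1) (by omega)
  rw [show l * m - (t - 1) = l * m - t + 1 by omega] at h1
  have : Finite (quotientFiltration l ϖ (l * m - t)) :=
    Nat.finite_of_card_ne_zero (h0 ▸ pow_ne_zero _ hlp.ne_zero)
  obtain ⟨hfin, hcount⟩ := ncard_image_diff quotient_powers_pow_eq_one (kummerField l K)
    (fun x y hx hy => kummerField_eq_iff hζ x y hx hy) _ _
    (quotientFiltration_antitone hϖ (Nat.le_succ (l * m - t)))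
  refine ⟨hfin, Nat.eq_of_mul_eq_mul_left hl1 ?_⟩
  rw [h0, Nat.succ_eq_add_one, h1, ← sub_one_mul_delta hlp.pos, ← sub_one_mul_delta hlp.pos] at hcount
  rw [mul_add]
  omega

end KummerSets

/-! ### Integers prime to `l` -/

section Numerics

-- ⌊t / l⌋ counts the multiples of `l` in [1, t]. This gives μ(t) / f its meaning.
open Classical in
theorem count_coprime {l : ℕ} [Fact l.Prime] {N t : ℕ} (ht : t < N) :
    Nat.count (fun s => 1 ≤ s ∧ s < N ∧ s.Coprime l) (t + 1) = t - t / l := by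
  have hlp : l.Prime := Fact.out
  induction t with
  | zero => simp [Nat.count_succ]
  | succ t ih =>
    have hle : t / l ≤ t := Nat.div_le_self t l
    rw [Nat.count_succ, ih (by omega), Nat.succ_div]
    by_cases h : l ∣ t + 1
    · have h' : ¬ (t + 1).Coprime l := fun hc =>
        (Nat.Prime.coprime_iff_not_dvd hlp).1 hc.symm h
      simp only [h, h', and_false, if_true, if_false]
      omega
    · have h' : (t + 1).Coprime l := ((Nat.Prime.coprime_iff_not_dvd hlp).2 h).symm
      rw [if_neg h, if_pos ⟨Nat.le_add_left 1 t, ht, h'⟩]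
      omega

theorem ncard_coprime {l : ℕ} [Fact l.Prime] {m : ℕ} (hm : 1 ≤ m) :
    {s : ℕ | 1 ≤ s ∧ s < l * m ∧ s.Coprime l}.ncard = (l - 1) * m := by
  classical
  have hlp : l.Prime := Fact.out
  have hpos : 0 < l * m := Nat.mul_pos hlp.pos hm
  have h := count_coprime (l := l) (N := l * m) (t := l * m - 1) (by omega)
  rw [Nat.sub_add_cancel hpos, Nat.count_eq_card_filter_range] at h
  have hset : {s : ℕ | 1 ≤ s ∧ s < l * m ∧ s.Coprime l} =
      ((Finset.range (l * m)).filter fun s => 1 ≤ s ∧ s < l * m ∧ s.Coprime l : Finset ℕ) := by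
    ext s
    simp only [Set.mem_ofPred_eq, Finset.coe_filter, Finset.mem_range]
    tauto
  rw [hset, Set.ncard_coe_finset, h]
  obtain ⟨k, rfl⟩ := Nat.exists_eq_add_of_le' hm
  have h1 : l * (k + 1) - 1 = l - 1 + l * k := by
    have := hlp.pos
    rw [mul_add]
    omega
  rw [h1, Nat.add_mul_div_left _ _ hlp.pos, Nat.div_eq_of_lt (Nat.sub_lt hlp.pos one_pos)]
  obtain ⟨j, rfl⟩ := Nat.exists_eq_add_of_lt hlp.one_lt
  have h2 : 1 + j + 1 - 1 = j + 1 := by omega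
  rw [h2]
  have : j + 1 + (1 + j + 1) * k = (j + 1) * (k + 1) + k := by ring
  omega

/-- Exactly i integers prime to `l` lie in [1, T] and i - 1 in [1, T - 1], which amounts to μ(t_i) =
i f and μ(t_i - 1) = (i - 1) f. The index is i - 1 because `Nat.nth` counts from 0. -/
theorem nth_coprime_spec {l : ℕ} [Fact l.Prime] {m : ℕ} (hm : 1 ≤ m) {i : ℕ} (hi1 : 1 ≤ i)
    (hi : i ≤ (l - 1) * m) :
    let T := Nat.nth (fun s => 1 ≤ s ∧ s < l * m ∧ s.Coprime l) (i - 1)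
    1 ≤ T ∧ T < l * m ∧ T - T / l = i ∧ (T - 1) - (T - 1) / l = i - 1 := by
  classical
  intro T
  have hfin : {s : ℕ | 1 ≤ s ∧ s < l * m ∧ s.Coprime l}.Finite :=
    (Set.finite_lt_nat (l * m)).subset fun s hs => hs.2.1
  have hlt : ∀ hf : (Set.ofPred fun s : ℕ => 1 ≤ s ∧ s < l * m ∧ s.Coprime l).Finite,
      i - 1 < hf.toFinset.card := by
    intro hf
    rw [← Set.ncard_eq_toFinset_card _ hf]
    have h : (Set.ofPred fun s : ℕ => 1 ≤ s ∧ s < l * m ∧ s.Coprime l).ncard = (l - 1) * m :=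
      ncard_coprime hm
    omega
  have hT := Nat.nth_mem (i - 1) hlt
  have hcount := Nat.count_nth hlt
  refine ⟨hT.1, hT.2.1, ?_, ?_⟩
  · rw [← count_coprime hT.2.1, Nat.count_succ, if_pos hT, hcount]
    omega
  · have h1 : 1 ≤ T := hT.1
    have h2 : T < l * m := hT.2.1
    rw [← count_coprime (N := l * m) (by omega : T - 1 < l * m), Nat.sub_add_cancel h1]
    exact hcount

theorem sum_Icc_pow_add_delta (l f i : ℕ) (hi : 1 ≤ i) :
    ∑ j ∈ Finset.Icc ((i - 1) * f + 1) (i * f), l ^ j + delta l ((i - 1) * f) =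
      delta l (i * f) := by
  obtain ⟨k, rfl⟩ := Nat.exists_eq_add_of_le' hi
  have h : Finset.Icc (k * f + 1) ((k + 1) * f) = Finset.Ico (k * f + 1) ((k + 1) * f + 1) := by
    ext x
    simp only [Finset.mem_Icc, Finset.mem_Ico]
    omega
  rw [Nat.add_sub_cancel, delta, delta, h, add_comm,
    Finset.sum_range_add_sum_Ico _ (by nlinarith)]

end Numerics

end LocalKummer

/-! ### The theorem -/

theorem corollary65 (l : ℕ) [Fact l.Prime] (K : Type*) [Field K] [Algebra ℚ_[l] K]
    [Algebra ℤ_[l] K] [IsScalarTower ℤ_[l] ℚ_[l] K] [FiniteDimensional ℚ_[l] K]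
    (hζ : ∃ ζ : Kˣ, orderOf ζ = l) :
    -- `e₁ = e / (l - 1)` is an integer
    (l - 1) * LocalKummer.eOne l K = LocalKummer.absRamIdx l K ∧
    -- the number of extensions with a given ramification break
    (∀ t : ℕ, 1 ≤ t → t ≤ l * LocalKummer.eOne l K →
      (LocalKummer.kummerWithBreak l K t).Finite ∧
      ((LocalKummer.kummerWithBreak l K t).ncard : ℤ) =
        (LocalKummer.delta l (LocalKummer.mu l K t) : ℤ) -
          (LocalKummer.delta l (LocalKummer.mu l K (t - 1)) : ℤ)) ∧
    -- among the multiples of `l`, it vanishes precisely for `t ≠ l e₁`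
    (∀ t : ℕ, 1 ≤ t → t ≤ l * LocalKummer.eOne l K → l ∣ t →
      ((LocalKummer.delta l (LocalKummer.mu l K t) : ℤ) -
          (LocalKummer.delta l (LocalKummer.mu l K (t - 1)) : ℤ) = 0 ↔
        t ≠ l * LocalKummer.eOne l K)) ∧
    -- there are exactly `e` numbers `t₁ < ⋯ < t_e` in `[1, l e₁[` prime to `l`
    {s : ℕ | 1 ≤ s ∧ s < l * LocalKummer.eOne l K ∧ s.Coprime l}.ncard =
      LocalKummer.absRamIdx l K ∧
    -- the number of extensions with a given valuation of the discriminant, `1 ≤ i ≤ e`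
    (∀ i : ℕ, 1 ≤ i → i ≤ LocalKummer.absRamIdx l K →
      (LocalKummer.kummerWithDiscrVal l K ((l - 1) * (1 + LocalKummer.tBreak l K i))).Finite ∧
      (LocalKummer.kummerWithDiscrVal l K ((l - 1) * (1 + LocalKummer.tBreak l K i))).ncard =
        ∑ j ∈ Finset.Icc ((i - 1) * LocalKummer.absResDeg l K + 1)
          (i * LocalKummer.absResDeg l K), l ^ j) ∧
    -- the same for the top break `t_{e+1} = l e₁`
    ((LocalKummer.kummerWithDiscrVal l K ((l - 1) * (1 + l * LocalKummer.eOne l K))).Finite ∧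
      (LocalKummer.kummerWithDiscrVal l K ((l - 1) * (1 + l * LocalKummer.eOne l K))).ncard =
        l ^ (1 + Module.finrank ℚ_[l] K)) := by
  classical
  have hlp : l.Prime := Fact.out
  have hl1 : 0 < l - 1 := Nat.sub_pos_of_lt hlp.one_lt
  obtain ⟨z, hz⟩ := hζ
  have hζ : IsPrimitiveRoot (z : K) l :=
    IsPrimitiveRoot.coe_units_iff.2 (IsPrimitiveRoot.iff_orderOf.2 hz)
  obtain ⟨ϖ, hϖ, hl⟩ := LocalKummer.exists_isUniformizer l K
  obtain ⟨m, hm1, hm⟩ := LocalKummer.exists_absVal_zeta_sub_one_eq hϖ hζ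
  have he := LocalKummer.absVal_prime_eq_pow hϖ hζ hm hl
  obtain rfl : m = LocalKummer.eOne l K := by
    rw [LocalKummer.eOne, ← he, Nat.mul_div_cancel_left _ hl1]
  have hcount := fun t ht1 ht =>
    LocalKummer.finite_and_ncard_image hϖ hζ hm hm1 rfl he (t := t) ht1 ht
  have hbreak := fun t ht1 ht =>
    LocalKummer.kummerWithBreak_eq_image hϖ hζ hm hm1 (t := t) ht1 ht
  have hdisc := fun t ht1 ht =>
    LocalKummer.kummerWithDiscrVal_eq_image hϖ hζ hm hm1 (t := t) ht1 ht
  have hpos : 1 ≤ l * LocalKummer.eOne l K := Nat.mul_pos hlp.pos hm1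
  -- At the top, μ goes from d to 1 + d, so the two sums differ by their last term only.
  have htop : LocalKummer.delta l (LocalKummer.mu l K (l * LocalKummer.eOne l K)) =
      LocalKummer.delta l (LocalKummer.mu l K (l * LocalKummer.eOne l K - 1)) +
        l ^ (1 + Module.finrank ℚ_[l] K) := by
    rw [LocalKummer.mu_top, LocalKummer.mu_top_sub_one he hm1, LocalKummer.delta,
      LocalKummer.delta, add_comm 1 (Module.finrank ℚ_[l] K), ← Finset.sum_range_succ]
  refine ⟨he, fun t ht1 ht => ?_, fun t ht1 ht hlt => ?_, ?_, fun i hi1 hi => ?_, ?_, ?_⟩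
  · rw [hbreak t ht1 ht, ← (hcount t ht1 ht).2]
    exact ⟨(hcount t ht1 ht).1, by push_cast; ring⟩
  · constructor
    · rintro h rfl
      rw [htop] at h
      have : 0 < l ^ (1 + Module.finrank ℚ_[l] K) := pow_pos hlp.pos _
      push_cast at h
      have h2 : ((l : ℤ) ^ (1 + Module.finrank ℚ_[l] K)) = 0 := by linarith
      exact absurd h2 (by exact_mod_cast this.ne')
    · intro hne
      -- When `l` divides t, both t and ⌊t / l⌋ increase by 1 from t - 1 to t.
      have hmu : LocalKummer.mu l K t = LocalKummer.mu l K (t - 1) := by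
        rw [LocalKummer.mu_of_lt (lt_of_le_of_ne ht hne), LocalKummer.mu_of_lt (by omega)]
        congr 1
        obtain ⟨s, rfl⟩ := Nat.exists_eq_add_of_le' ht1
        have h1 := Nat.succ_div_of_dvd hlt
        rw [Nat.add_sub_cancel]
        omega
      rw [hmu, sub_self]
  · rw [LocalKummer.ncard_coprime hm1, he]
  · obtain ⟨hT1, hT, hTi, hTi'⟩ := LocalKummer.nth_coprime_spec (l := l) hm1 hi1 (he ▸ hi)
    change 1 ≤ LocalKummer.tBreak l K i at hT1
    change LocalKummer.tBreak l K i < _ at hT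
    change LocalKummer.tBreak l K i - LocalKummer.tBreak l K i / l = i at hTi
    change LocalKummer.tBreak l K i - 1 - (LocalKummer.tBreak l K i - 1) / l = i - 1 at hTi'
    have h := hcount _ hT1 hT.le
    rw [← hdisc _ hT1 hT.le, LocalKummer.mu_of_lt hT, LocalKummer.mu_of_lt (by omega), hTi,
      hTi'] at h
    refine ⟨h.1, ?_⟩
    have h2 := LocalKummer.sum_Icc_pow_add_delta l (LocalKummer.absResDeg l K) i hi1
    omega
  · rw [hdisc _ hpos le_rfl]
    exact (hcount _ hpos le_rfl).1
  · have h := (hcount _ hpos le_rfl).2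
    rw [htop] at h
    rw [hdisc _ hpos le_rfl]
    omega
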